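/- Let $\nu$ be a non-zero finite Borel measure on the open interval $(0,1)$. **$L^q$-spectrum.** For $n\in\mathbb N$ and $0\le k<2^n$ put $A_n^k=(k2^{-n},(k+1)2^{-n}]$, and for $q\in\mathbb R$ put $$\beta_n(q)=\frac{1}{\log 2^n}\log\sum_{k\,:\,\nu(A_n^k)>0}\nu(A_n^k)^q,\qquad \beta_\nu(q)=\limsup_{n\to\infty}\beta_n(q)\in[-\infty,\infty].$$ For all sufficiently large $n$ the function $\beta_n$ has exactly one fixed point $q_n\in\mathbb R$, $\beta_n(q_n)=q_n$; put $\overline q_\nu=\limsup_{n\to\infty}q_n$. The measure $\nu$ is called *$L^q$-regular* if * there is $\varepsilon>0$ with $\beta_\nu(q)=\liminf_{n}\beta_n(q)$ for all $q\in(\overline q_\nu-\varepsilon,\overline q_\nu)$, or * $\beta_\nu(\overline q_\nu)=\liminf_n\beta_n(\overline q_\nu)$, and $\beta_\nu$ is finite near $\overline q_\nu$ and differentiable at $\overline q_\nu$. **Optimized coarse multifractal dimensions.** For $\alpha>0$ let $\mathcal N_\alpha(n)$ be the number of $k\in\{0,\dots,2^n-1\}$ with $\nu(A_n^k)\ge 2^{-\alpha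 n}$, and put $$\overline F_\nu=\sup_{\alpha>0}\frac{1}{1+\alpha}\limsup_{n\to\infty}\frac{\log^+\mathcal N_\alpha(n)}{\log 2^n},\qquad \underline F_\nu=\sup_{\alpha>0}\frac{1}{1+\alpha}\liminf_{n\to\infty}\frac{\log^+\mathcal N_\alpha(n)}{\log 2^n}.$$ The measure $\nu$ is called *MF-regular* if $\underline F_\nu=\overline F_\nu$. **Spectral dimension.** Let $\mathcal D_\nu$ be the space of all continuous $f:[0,1]\to\mathbb R$ with $f(0)=f(1)=0$ that are of the form $f(x)=\int_0^x\nabla f\,d\Lambda$ with $\nabla f\in L^2([0,1],\Lambda)$, where $\Lambda$ is Lebesgue measure, and that are affine on each connected component of $[0,1]\setminus\operatorname{supp}\nu$. A function $f\in\mathcal D_\nu\setminus\{0\}$ is an eigenfunction with eigenvalue $\lambda$ if $\int_0^1\nabla f\,\nabla g\,d\Lambda=\lambda\int fg\,d\nu$ for all $g\in\mathcal D_\nu$. Let $N_\nu(x)$ be the number of eigenvalues not exceeding $x$, counted with multiplicity. The spectral dimension of $\nu$ exists and equals $s$ if $$\liminf_{x\to\infty}\frac{\log N_\nu(x)}{\log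 x}=\limsup_{x\to\infty}\frac{\log N_\nu(x)}{\log x}=s.$$ **Theorem.** If $\nu$ is $L^q$-regular, then $\nu$ is MF-regular, and the spectral dimension of $\nu$ exists and equals $\overline q_\nu$. -/

import Mathlib

open Set Filter Topology MeasureTheory
open scoped ENNReal

noncomputable section

namespace KreinFeller

/-! Throughout, `ν` is a finite Borel measure on the open interval `(0,1)`, represented as a
measure on `ℝ` with `ν (Ioo 0 1)ᶜ = 0`. -/

/-! ### The Kreĭn-Feller form and its eigenvalue counting function -/

/-- `g` is a square integrable derivative of `f` on `[0,1]`: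
`g ∈ L²([0,1])` and `f x = f 0 + ∫_{[0,x]} g` for all `x ∈ [0,1]`. -/
def HasGrad (f g : ℝ → ℝ) : Prop :=
  MemLp g 2 (volume.restrict (Icc 0 1)) ∧
    ∀ x ∈ Icc (0 : ℝ) 1, f x = f 0 + ∫ t in Icc 0 x, g t

/-- The Sobolev space `H¹₀(0,1)`. Its elements are functions on `[0,1]` that vanish at `0` and `1`;
they are represented by their extensions by zero to `ℝ`. -/
def H10 : Set (ℝ → ℝ) :=
  {f | (∃ g, HasGrad f g) ∧ ∀ x, x ∉ Ioo (0 : ℝ) 1 → f x = 0}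

open Classical in
/-- The weak derivative of `f` on `[0,1]` (unique up to Lebesgue null sets where it exists). -/
def grad (f : ℝ → ℝ) : ℝ → ℝ :=
  if h : ∃ g, HasGrad f g then h.choose else 0

/-- The functions that are continuous on `[0,1]` and affine on each connected component of
`[0,1] \ supp ν`. -/
def Cnu (ν : Measure ℝ) : Set (ℝ → ℝ) :=
  {f | ContinuousOn f (Icc 0 1) ∧
    ∀ x ∈ Icc (0 : ℝ) 1 \ ν.support, ∃ c d : ℝ,
      ∀ y ∈ connectedComponentIn (Icc (0 : ℝ) 1 \ ν.support) x, f y = c * y + d}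

/-- The (Dirichlet) domain of the form. -/
def dom (ν : Measure ℝ) : Set (ℝ → ℝ) := H10 ∩ Cnu ν

/-- The form `∫_{(0,1)} ∇f ∇g dΛ`. -/
def form (f g : ℝ → ℝ) : ℝ := ∫ t in Ioo (0 : ℝ) 1, grad f t * grad g t

/-- `f` is an eigenfunction of the form with eigenvalue `l`. -/
def IsEigenfunction (ν : Measure ℝ) (l : ℝ) (f : ℝ → ℝ) : Prop :=
  f ∈ dom ν ∧ f ≠ 0 ∧ ∀ g ∈ dom ν, form f g = l * ∫ t, f t * g t ∂ν

/-- The eigenvalue counting function: the number of eigenvalues not exceeding `x`, counted with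
multiplicity, i.e. the dimension of the span of all eigenfunctions with eigenvalue at most `x`. -/
def eigenCount (ν : Measure ℝ) (x : ℝ) : ℕ∞ :=
  Cardinal.toENat
    (Module.rank ℝ (Submodule.span ℝ {f : ℝ → ℝ | ∃ l ≤ x, IsEigenfunction ν l f}))

/-- `log N_ν(x) / log x`, as an extended real number. -/
def spectralRatio (ν : Measure ℝ) (x : ℝ) : EReal :=
  ENNReal.log ((eigenCount ν x : ℕ∞) : ℝ≥0∞) / ((Real.log x : ℝ) : EReal)

/-- The lower spectral dimension. -/
def lowerSpectralDim (ν : Measure ℝ) : EReal := liminf (spectralRatio ν) atTop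

/-- The upper spectral dimension. -/
def upperSpectralDim (ν : Measure ℝ) : EReal := limsup (spectralRatio ν) atTop

/-- The spectral dimension exists and equals `s`. -/
def HasSpectralDim (ν : Measure ℝ) (s : ℝ) : Prop :=
  lowerSpectralDim ν = (s : EReal) ∧ upperSpectralDim ν = (s : EReal)

/-! ### The `L^q`-spectrum -/

/-- The dyadic interval `(k 2⁻ⁿ, (k+1) 2⁻ⁿ]`. -/
def dyadic (n k : ℕ) : Set ℝ := Ioc ((k : ℝ) / 2 ^ n) (((k : ℝ) + 1) / 2 ^ n)

open Classical in
/-- `β_n(q) = (log 2ⁿ)⁻¹ log ∑ ν(C)^q`, the sum being over the dyadic intervals `C` of level `n`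
in `(0,1]` with positive measure. -/
def betaN (ν : Measure ℝ) (n : ℕ) (q : ℝ) : ℝ :=
  Real.log (∑ k ∈ (Finset.range (2 ^ n)).filter (fun k => 0 < ν (dyadic n k)),
    ν.real (dyadic n k) ^ q) / Real.log (2 ^ n)

/-- For all large `n` the function `β_n` has exactly one fixed point. -/
theorem eventually_existsUnique_fixedPoint (ν : Measure ℝ) [IsFiniteMeasure ν] (hν : ν ≠ 0)
    (hsupp : ν (Ioo 0 1)ᶜ = 0) : ∀ᶠ n : ℕ in atTop, ∃! q : ℝ, betaN ν n q = q := by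
  classical
  have h1 : ∀ᶠ n : ℕ in atTop, ν.real univ < (2 : ℝ) ^ n :=
    (tendsto_pow_atTop_atTop_of_one_lt (by norm_num : (1 : ℝ) < 2)).eventually_gt_atTop _
  filter_upwards [h1, eventually_ge_atTop 1] with n hn hn1
  set S := (Finset.range (2 ^ n)).filter (fun k => 0 < ν (dyadic n k)) with hS
  have h2n : (0 : ℝ) < 2 ^ n := by positivity
  have hlog : 0 < Real.log ((2 : ℝ) ^ n) :=
    Real.log_pos (one_lt_pow₀ (by norm_num) (by omega))
  have hcover : Ioo (0 : ℝ) 1 ⊆ ⋃ k ∈ Finset.range (2 ^ n), dyadic n k := by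
    intro x hx
    have hy : 0 < x * 2 ^ n := mul_pos hx.1 h2n
    have hc : 0 < ⌈x * 2 ^ n⌉₊ := Nat.ceil_pos.2 hy
    obtain ⟨k, hk⟩ : ∃ k, ⌈x * 2 ^ n⌉₊ = k + 1 := ⟨_, (Nat.succ_pred_eq_of_pos hc).symm⟩
    have hle := Nat.le_ceil (x * 2 ^ n)
    have hlt : ((k : ℕ) : ℝ) < x * 2 ^ n := Nat.lt_ceil.1 (by omega)
    rw [hk] at hle
    push_cast at hle
    have hk2 : k < 2 ^ n := by
      have : (k : ℝ) < 2 ^ n := hlt.trans (by nlinarith [hx.2])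
      exact_mod_cast this
    simp only [mem_iUnion, Finset.mem_range]
    exact ⟨k, hk2, (div_lt_iff₀ h2n).2 hlt, (le_div_iff₀ h2n).2 hle⟩
  have hSne : S.Nonempty := by
    by_contra hne
    rw [Finset.not_nonempty_iff_eq_empty, hS, Finset.filter_eq_empty_iff] at hne
    have h0 : ν (Ioo 0 1) = 0 := by
      refine measure_mono_null hcover ?_
      exact measure_iUnion_null fun k => measure_iUnion_null fun hk => by simpa using hne hk
    apply hν
    rw [← Measure.measure_univ_eq_zero, ← union_compl_self (Ioo (0 : ℝ) 1)]
    exact measure_union_null h0 hsupp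
  have hp : ∀ k ∈ S, 0 < ν.real (dyadic n k) := fun k hk =>
    ENNReal.toReal_pos (Finset.mem_filter.1 hk).2.ne' (measure_ne_top _ _)
  have hb0 : ∀ k ∈ S, 0 < ν.real (dyadic n k) / 2 ^ n := fun k hk => div_pos (hp k hk) h2n
  have hb1 : ∀ k ∈ S, ν.real (dyadic n k) / 2 ^ n < 1 := fun k _ =>
    (div_lt_one h2n).2 ((measureReal_mono (subset_univ _)).trans_lt hn)
  set g : ℝ → ℝ := fun q => ∑ k ∈ S, (ν.real (dyadic n k) / 2 ^ n) ^ q with hg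
  have hiff : ∀ q, betaN ν n q = q ↔ g q = 1 := by
    intro q
    have hsum : 0 < ∑ k ∈ S, ν.real (dyadic n k) ^ q :=
      Finset.sum_pos (fun k hk => Real.rpow_pos_of_pos (hp k hk) q) hSne
    have hgq : g q = (∑ k ∈ S, ν.real (dyadic n k) ^ q) / ((2 : ℝ) ^ n) ^ q := by
      rw [hg, Finset.sum_div]
      exact Finset.sum_congr rfl fun k hk => Real.div_rpow (hp k hk).le h2n.le q
    have hpow : 0 < ((2 : ℝ) ^ n) ^ q := Real.rpow_pos_of_pos h2n q
    rw [hgq, div_eq_one_iff_eq hpow.ne', betaN, div_eq_iff hlog.ne', ← Real.log_rpow h2n]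
    exact ⟨fun h => Real.log_injOn_pos hsum hpow h, fun h => congrArg _ h⟩
  have hanti : StrictAnti g := fun a b hab =>
    Finset.sum_lt_sum_of_nonempty hSne fun k hk =>
      Real.rpow_lt_rpow_of_exponent_gt (hb0 k hk) (hb1 k hk) hab
  have hcont : Continuous g :=
    continuous_finsetSum _ fun k hk =>
      Real.continuous_const_rpow (hb0 k hk).ne'
  have hlim : Tendsto g atTop (𝓝 0) := by
    have := tendsto_finsetSum S fun k hk =>
      tendsto_rpow_atTop_of_base_lt_one _ (by linarith [hb0 k hk]) (hb1 k hk)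
    simpa using this
  have hg0 : 1 ≤ g 0 := by
    simp only [hg, Real.rpow_zero, Finset.sum_const, nsmul_eq_mul, mul_one]
    exact_mod_cast hSne.card_pos
  obtain ⟨b, hb, hb'⟩ := ((hlim.eventually_lt_const one_pos).and (eventually_ge_atTop 0)).exists
  obtain ⟨q, -, hq⟩ := intermediate_value_Icc' hb' hcont.continuousOn ⟨hb.le, hg0⟩
  exact ⟨q, (hiff q).2 hq, fun r hr => hanti.injective (((hiff r).1 hr).trans hq.symm)⟩

/-- The `L^q`-spectrum `β_ν(q) = limsup β_n(q)`; it may be infinite for `q < 0`. -/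
def beta (ν : Measure ℝ) (q : ℝ) : EReal :=
  limsup (fun n : ℕ => ((betaN ν n q : ℝ) : EReal)) atTop

/-- `liminf β_n(q)`. -/
def lowerBeta (ν : Measure ℝ) (q : ℝ) : EReal :=
  liminf (fun n : ℕ => ((betaN ν n q : ℝ) : EReal)) atTop

/-- The fixed point `q_n` of `β_n`. For a non-zero finite measure and all large `n` the set of fixed
points has exactly one element (lemma `eventually_existsUnique_fixedPoint`), so the infimum is that
element. -/
def fixedPt (ν : Measure ℝ) (n : ℕ) : ℝ := sInf (Function.fixedPoints (betaN ν n))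

/-- `limsup q_n` (the sequence is bounded). -/
def qBar (ν : Measure ℝ) : ℝ := limsup (fixedPt ν) atTop

/-- `L^q`-regularity: `β_ν = liminf β_n` on some interval `(q̄ - ε, q̄)`, or `β_ν = liminf β_n` at
`q̄` and `β_ν` is (finite near `q̄` and) differentiable at `q̄`. -/
def LqRegular (ν : Measure ℝ) : Prop :=
  (∃ ε > 0, ∀ q ∈ Ioo (qBar ν - ε) (qBar ν), beta ν q = lowerBeta ν q) ∨
  (beta ν (qBar ν) = lowerBeta ν (qBar ν) ∧
    (∀ᶠ q in 𝓝 (qBar ν), beta ν q ≠ ⊤ ∧ beta ν q ≠ ⊥) ∧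
    DifferentiableAt ℝ (fun q => (beta ν q).toReal) (qBar ν))

/-! ### Optimized coarse multifractal dimensions -/

open Classical in
/-- The number of dyadic intervals of level `n` in `(0,1]` with measure at least `2^{-αn}`. -/
def coarseCount (ν : Measure ℝ) (α : ℝ) (n : ℕ) : ℕ :=
  ((Finset.range (2 ^ n)).filter
    (fun k => (2 : ℝ) ^ (-α * n) ≤ ν.real (dyadic n k))).card

/-- `log⁺ N_α(n) / log 2ⁿ`, a number in `[0,1]`. -/
def coarseRatio (ν : Measure ℝ) (α : ℝ) (n : ℕ) : ℝ :=
  Real.posLog (coarseCount ν α n) / Real.log (2 ^ n)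

/-- The upper optimized coarse multifractal dimension. -/
def upperF (ν : Measure ℝ) : ℝ :=
  ⨆ α : Ioi (0 : ℝ), limsup (coarseRatio ν α) atTop / (1 + (α : ℝ))

/-- The lower optimized coarse multifractal dimension. -/
def lowerF (ν : Measure ℝ) : ℝ :=
  ⨆ α : Ioi (0 : ℝ), liminf (coarseRatio ν α) atTop / (1 + (α : ℝ))

/-- `ν` is MF-regular. -/
def MFRegular (ν : Measure ℝ) : Prop := lowerF ν = upperF ν

end KreinFeller

end

/-! Everything follows from the cycle `qBar ≤ lowerF ≤ upperF ≤ qBar`, together with `lowerF ≤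
lowerSpectralDim` (for positive levels) and `upperSpectralDim ≤ qBar`. Only the first inequality,
`qBar_le_lowerF`, uses regularity.

Spectral side. Functions of the form domain are encoded by their derivatives in `L²([0,1])`, where
evaluation at a point is the inner product with an indicator. The mass form `∫ f_g f_h dν` becomes a
compact positive operator `massOp`, and an eigenvalue `l` of the form is an eigenvalue `l⁻¹` of
`massOp`. For the upper bound, a dyadic interval `C` is heavy if `ν(C)|C| ≥ 1/(2x)`. A function
vanishing at the midpoints of all heavy intervals has too little mass to lie in the span of the
eigenfunctions up to `x`, so the heavy intervals bound the counting function (`eigenCount_le`). If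
`q > qBar`, then `β_n(q) ≤ q` for large `n`, so a Chebyshev estimate bounds the heavy intervals of
each such level by a multiple of `x^q`, and only about `log x` levels occur. For the lower bound,
trapezoids over the intervals of mass at least `2^{-αn}` form a test space, and min-max turns coarse
counts into eigenvalue counts (`coarseCount_le`).

Fractal side. Chebyshev also gives `upperF ≤ qBar`. For `qBar ≤ lowerF`, take `q` where `β` is
differentiable, `β_n(q)` converges and `β(q) ≥ q`, and put `α₀ = -β'(q)`. Comparison with the
exponents `q ± h` shows that the partition sum at `q` is carried by intervals of mass about
`2^{-α₀n}`. There are then at least about `2^{n(β(q)+α₀q)}` of them, which is at least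
`2^{nq(1+α₀)}`; dividing by `1 + α₀` gives `q` (`le_lowerF_of_differentiableAt`). Such `q` exist
arbitrarily close to `qBar`, or at `qBar` itself, according to the two alternatives of `LqRegular`;
in the first one, monotonicity of `β` already gives differentiability almost everywhere. -/

open Set Filter Topology MeasureTheory
open scoped ENNReal

noncomputable section

namespace KreinFeller

open scoped InnerProductSpace

/-! ### Min-max estimates for compact positive operators -/

section MinMax

open Module.End

variable {E : Type*} [NormedAddCommGroup E] [InnerProductSpace ℝ E]

/-- The vectors `v` with `T v = l⁻¹ v` for some `0 < l ≤ x`. -/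
def recipEigen (T : E →L[ℝ] E) (x : ℝ) : Set E :=
  {v | ∃ l, 0 < l ∧ l ≤ x ∧ l • T v = v}

/-- Eigenspaces of a symmetric operator are orthogonal, so both quadratic forms are diagonal on the
span; the inequality then holds term by term because `l ≤ x`. -/
theorem norm_sq_le_of_mem_span_recipEigen {T : E →L[ℝ] E} (hT : T.IsSymmetric) {x : ℝ} {v : E}
    (hv : v ∈ Submodule.span ℝ (recipEigen T x)) : ‖v‖ ^ 2 ≤ x * ⟪T v, v⟫_ℝ := by
  classical
  have hle : Submodule.span ℝ (recipEigen T x) ≤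
      ⨆ l : {l : ℝ // 0 < l ∧ l ≤ x}, eigenspace (T : E →ₗ[ℝ] E) ((l : ℝ)⁻¹) := by
    refine Submodule.span_le.2 ?_
    rintro v ⟨l, hl0, hlx, hl⟩
    refine Submodule.mem_iSup_of_mem ⟨l, hl0, hlx⟩ ?_
    rw [mem_eigenspace_iff]
    nth_rewrite 2 [← hl]
    rw [smul_smul, inv_mul_cancel₀ hl0.ne', one_smul]
    rfl
  obtain ⟨f, rfl⟩ := (Submodule.mem_iSup_iff_exists_dfinsupp' _ _).1 (hle hv)
  have horth : ∀ l m : {l : ℝ // 0 < l ∧ l ≤ x}, l ≠ m → ⟪(f l : E), (f m : E)⟫_ℝ = 0 := by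
    intro l m hlm
    have h : (l : ℝ)⁻¹ ≠ (m : ℝ)⁻¹ := fun h => hlm (Subtype.ext (inv_injective h))
    exact hT.orthogonalFamily_eigenspaces h (f l) (f m)
  have hTf : ∀ l, T (f l : E) = (l : ℝ)⁻¹ • (f l : E) := fun l =>
    mem_eigenspace_iff.1 (f l).2
  simp only [DFinsupp.sum]
  have h1 : ‖∑ i ∈ f.support, (f i : E)‖ ^ 2 = ∑ i ∈ f.support, ‖(f i : E)‖ ^ 2 := by
    rw [← real_inner_self_eq_norm_sq, sum_inner]
    refine Finset.sum_congr rfl fun i hi => ?_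
    rw [inner_sum, Finset.sum_eq_single i (fun j _ hj => horth i j (Ne.symm hj))
      (fun h => (h hi).elim), real_inner_self_eq_norm_sq]
  have h2 : ⟪T (∑ i ∈ f.support, (f i : E)), ∑ i ∈ f.support, (f i : E)⟫_ℝ =
      ∑ i ∈ f.support, (i : ℝ)⁻¹ * ‖(f i : E)‖ ^ 2 := by
    rw [map_sum, sum_inner]
    refine Finset.sum_congr rfl fun i hi => ?_
    rw [hTf, inner_smul_left, inner_sum,
      Finset.sum_eq_single i (fun j _ hj => horth i j (Ne.symm hj))
      (fun h => (h hi).elim), real_inner_self_eq_norm_sq]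
    rfl
  rw [h1, h2, Finset.mul_sum]
  refine Finset.sum_le_sum fun i _ => ?_
  rw [← mul_assoc]
  refine le_mul_of_one_le_left (sq_nonneg _) ?_
  rw [← div_eq_mul_inv, one_le_div i.2.1]
  exact i.2.2

variable [CompleteSpace E]

/-- The norm of a nonzero compact positive operator is an eigenvalue. -/
theorem exists_eigenvector_norm {T : E →L[ℝ] E} (hc : IsCompactOperator T) (hT : T.IsSymmetric)
    (hpos : ∀ v, 0 ≤ ⟪T v, v⟫_ℝ) (hT0 : T ≠ 0) : ∃ v, v ≠ 0 ∧ T v = ‖T‖ • v := by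
  have : Nontrivial E := by
    by_contra h
    rw [not_nontrivial_iff_subsingleton] at h
    exact hT0 (ContinuousLinearMap.ext fun v => Subsingleton.elim _ _)
  have hn : ‖T‖ ≠ 0 := norm_ne_zero_iff.2 hT0
  -- If `‖T‖` were in the resolvent set, the Rayleigh quotient would stay below `‖T‖ - ε`. By
  -- positivity its supremum is also the supremum of its absolute value, which is `‖T‖`.
  have hmem : ‖T‖ ∈ spectrum ℝ T := by
    by_contra h
    obtain ⟨ε, hε, hle⟩ := T.rayleighQuotient_le_of_norm_mem_resolventSet (𝕜 := ℝ)
      (by simpa [spectrum] using h)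
    have := ContinuousLinearMap.norm_eq_iSup_rayleighQuotient T hT
    have h2 : (⨆ x, |T.rayleighQuotient x|) ≤ ‖T‖ - ε := by
      refine ciSup_le fun x => ?_
      rw [abs_of_nonneg]
      · exact hle x
      · exact div_nonneg (hpos x) (sq_nonneg _)
    linarith
  rw [← hc.hasEigenvalue_iff_mem_spectrum hn] at hmem
  obtain ⟨v, hv⟩ := hmem.exists_hasEigenvector
  exact ⟨v, hv.2, hv.apply_eq_smul⟩

/-- A space of dimension `d` on which the Rayleigh quotient is at most `x` forces at least
`d` eigenvalues not exceeding `x`. -/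
theorem card_le_rank_span_recipEigen {T : E →L[ℝ] E} (hc : IsCompactOperator T)
    (hT : T.IsSymmetric) (hpos : ∀ v, 0 ≤ ⟪T v, v⟫_ℝ) {ι : Type*} [Fintype ι] {x : ℝ} (hx : 0 < x)
    (L : (ι → ℝ) →ₗ[ℝ] E) (hL : ∀ c, c ≠ 0 → L c ≠ 0)
    (hLx : ∀ c, ‖L c‖ ^ 2 ≤ x * ⟪T (L c), L c⟫_ℝ) :
    (Fintype.card ι : Cardinal) ≤ Module.rank ℝ (Submodule.span ℝ (recipEigen T x)) := by
  set W := Submodule.span ℝ (recipEigen T x) with hW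
  by_contra! hlt
  have hfin : FiniteDimensional ℝ W :=
    Module.rank_lt_aleph0_iff.1 (hlt.trans (Cardinal.natCast_lt_aleph0))
  have hlt' : Module.finrank ℝ W < Module.finrank ℝ (ι → ℝ) := by
    rw [Module.finrank_fintype_fun_eq_card]
    rw [← Module.finrank_eq_rank] at hlt
    exact_mod_cast hlt
  -- Too few eigenvectors leave a nonzero test vector orthogonal to `W`. It forces the restriction
  -- of `T` to `Wᗮ` to have norm at least `1/x`; that norm is an eigenvalue, whose eigenvector lies
  -- in both `W` and `Wᗮ`.
  obtain ⟨c, hc0, hcne⟩ := (Submodule.ne_bot_iff _).1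
    (LinearMap.ker_ne_bot_of_finrank_lt (f := (W.orthogonalProjectionOnto : E →ₗ[ℝ] W) ∘ₗ L) hlt')
  have hu : L c ∈ Wᗮ := by
    rw [← Submodule.orthogonalProjectionOnto_eq_zero_iff]
    exact hc0
  have hinvW : ∀ w ∈ W, T w ∈ W := by
    intro w hw
    refine Submodule.span_induction (p := fun w _ => T w ∈ W) ?_ ?_ ?_ ?_ hw
    · rintro v ⟨l, hl0, hlx, hl⟩
      have : T v = l⁻¹ • v := by
        nth_rewrite 2 [← hl]
        rw [smul_smul, inv_mul_cancel₀ hl0.ne', one_smul]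
      rw [this]
      exact W.smul_mem _ (Submodule.subset_span ⟨l, hl0, hlx, hl⟩)
    · simp
    · intro a b _ _ ha hb
      rw [map_add]
      exact W.add_mem ha hb
    · intro a b _ hb
      rw [map_smul]
      exact W.smul_mem _ hb
  have hinv : ∀ v ∈ Wᗮ, T v ∈ Wᗮ := by
    intro v hv
    rw [Submodule.mem_orthogonal] at hv ⊢
    intro w hw
    rw [← hv _ (hinvW w hw)]
    exact (hT w v).symm
  let R : Wᗮ →L[ℝ] Wᗮ := T.restrict hinv
  have hRc : IsCompactOperator R := hc.restrict' hinv
  have hRs : R.IsSymmetric := hT.restrict_invariant hinv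
  have hRp : ∀ v, 0 ≤ ⟪R v, v⟫_ℝ := fun v => hpos v
  have hune : L c ≠ 0 := hL c hcne
  have hupos : 0 < ‖L c‖ ^ 2 := by positivity
  have h1 : ⟪T (L c), L c⟫_ℝ ≤ ‖R‖ * ‖L c‖ ^ 2 := by
    have h2 : ‖R ⟨L c, hu⟩‖ ≤ ‖R‖ * ‖L c‖ := R.le_opNorm _
    calc ⟪T (L c), L c⟫_ℝ ≤ ‖T (L c)‖ * ‖L c‖ := real_inner_le_norm _ _
      _ ≤ (‖R‖ * ‖L c‖) * ‖L c‖ := mul_le_mul_of_nonneg_right h2 (norm_nonneg _)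
      _ = _ := by ring
  have h3 : 1 ≤ x * ‖R‖ := by
    have := (hLx c).trans (mul_le_mul_of_nonneg_left h1 hx.le)
    by_contra! h
    nlinarith
  have hRpos : 0 < ‖R‖ := by
    by_contra! h
    nlinarith [norm_nonneg R]
  obtain ⟨v, hv0, hv⟩ := exists_eigenvector_norm hRc hRs hRp (norm_pos_iff.1 hRpos)
  have hvT : T (v : E) = ‖R‖ • (v : E) := congrArg Subtype.val hv
  have hvW : (v : E) ∈ W := by
    refine Submodule.subset_span ⟨‖R‖⁻¹, by positivity, ?_, ?_⟩
    · rw [inv_le_iff_one_le_mul₀ hRpos]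
      exact h3
    · rw [hvT, smul_smul, inv_mul_cancel₀ hRpos.ne', one_smul]
  have : (v : E) = 0 := by
    have := Submodule.mem_orthogonal _ _ |>.1 v.2 _ hvW
    exact inner_self_eq_zero.1 this
  exact hv0 (Subtype.ext this)

/-- A positive operator whose quadratic form is small off finite dimensional subspaces is
compact. -/
theorem isCompactOperator_of_forall_finiteDimensional {T : E →L[ℝ] E} (hT : T.IsSymmetric)
    (hpos : ∀ v, 0 ≤ ⟪T v, v⟫_ℝ)
    (h : ∀ ε > 0, ∃ G : Submodule ℝ E, FiniteDimensional ℝ G ∧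
      ∀ u ∈ Gᗮ, ⟪T u, u⟫_ℝ ≤ ε * ‖u‖ ^ 2) : IsCompactOperator T := by
  set C : ℝ := ‖T‖ + 1 with hC
  -- The summand `1` keeps `C` positive when `T = 0`. The next bound comes from positivity of the
  -- form at `u - C⁻¹ T u`; it upgrades smallness of `⟪T u, u⟫` to smallness of `‖T u‖`.
  have hC0 : 0 < C := by positivity
  have hsq : ∀ u, ‖T u‖ ^ 2 ≤ C * ⟪T u, u⟫_ℝ := by
    intro u
    have h1 := hpos (u - C⁻¹ • T u)
    have h2 : ⟪T (T u), T u⟫_ℝ ≤ C * ‖T u‖ ^ 2 := by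
      have h3 : ‖T (T u)‖ ≤ C * ‖T u‖ := (T.le_opNorm _).trans
        (mul_le_mul_of_nonneg_right (by simp [hC]) (norm_nonneg _))
      calc ⟪T (T u), T u⟫_ℝ ≤ ‖T (T u)‖ * ‖T u‖ := real_inner_le_norm _ _
        _ ≤ C * ‖T u‖ * ‖T u‖ := mul_le_mul_of_nonneg_right h3 (norm_nonneg _)
        _ = _ := by ring
    have h4 : ⟪T (T u), u⟫_ℝ = ‖T u‖ ^ 2 := by
      rw [← real_inner_self_eq_norm_sq]
      exact hT (T u) u
    rw [map_sub, map_smul, inner_sub_left, inner_sub_right, inner_sub_right,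
      real_inner_smul_left, real_inner_smul_left, real_inner_smul_right, real_inner_smul_right,
      real_inner_self_eq_norm_sq, h4] at h1
    have h5 : C⁻¹ * (C⁻¹ * ⟪T (T u), T u⟫_ℝ) ≤ C⁻¹ * (C⁻¹ * (C * ‖T u‖ ^ 2)) := by gcongr
    rw [inv_mul_cancel_left₀ hC0.ne'] at h5
    have h6 : C⁻¹ * ‖T u‖ ^ 2 ≤ ⟪T u, u⟫_ℝ := by linarith
    rwa [inv_mul_le_iff₀ hC0] at h6
  choose G hGfin hG using fun n : ℕ => h (1 / ((n : ℝ) + 1)) (by positivity)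
  -- Composing with the projections onto `G n` gives finite rank operators that converge to `T` in
  -- norm.
  refine isCompactOperator_of_tendsto (l := atTop)
    (F := fun n => T ∘L (G n).starProjection) ?_ (Eventually.of_forall fun n => ?_)
  · rw [tendsto_iff_norm_sub_tendsto_zero]
    have hbound : ∀ n, ‖T ∘L (G n).starProjection - T‖ ≤ √(C * (1 / ((n : ℝ) + 1))) := by
      intro n
      refine ContinuousLinearMap.opNorm_le_bound _ (Real.sqrt_nonneg _) fun v => ?_
      set u := v - (G n).starProjection v with hu
      have huG : u ∈ (G n)ᗮ := Submodule.sub_starProjection_mem_orthogonal v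
      have hun : ‖u‖ ≤ ‖v‖ := by
        rw [hu, ← Submodule.starProjection_orthogonal_val]
        exact Submodule.norm_starProjection_apply_le _ v
      have e : (T ∘L (G n).starProjection - T) v = -T u := by simp [hu]
      rw [e, norm_neg]
      refine abs_le_of_sq_le_sq' ?_ (by positivity) |>.2
      rw [mul_pow, Real.sq_sqrt (by positivity)]
      calc ‖T u‖ ^ 2 ≤ C * (1 / ((n : ℝ) + 1) * ‖u‖ ^ 2) :=
            (hsq u).trans (mul_le_mul_of_nonneg_left (hG n u huG) hC0.le)
        _ ≤ C * (1 / ((n : ℝ) + 1) * ‖v‖ ^ 2) := by gcongr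
        _ = _ := by ring
    refine squeeze_zero (fun n => norm_nonneg _) hbound ?_
    have : Tendsto (fun n : ℕ => √(C * (1 / ((n : ℝ) + 1)))) atTop (𝓝 (√(C * 0))) :=
      (Real.continuous_sqrt.tendsto _).comp (tendsto_one_div_add_atTop_nhds_zero_nat.const_mul C)
    simpa using this
  · have : LocallyCompactSpace (G n) := LocallyCompactSpace.of_finiteDimensional_of_complete ℝ _
    have : IsCompactOperator ((G n).subtypeL ∘L (G n).orthogonalProjectionOnto) :=
      (isCompactOperator_of_locallyCompactSpace_dom
        (G n).orthogonalProjectionOnto).clm_comp (G n).subtypeL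
    exact this.clm_comp T

end MinMax

/-! ### Realisation of the form domain inside `L²([0,1])` -/

/-- The space `L²([0,1])` of weak derivatives. -/
abbrev GradSpace : Type := Lp ℝ 2 (volume.restrict (Icc (0 : ℝ) 1))

/-- The indicator function of `[0,x]` as an element of `L²([0,1])`. -/
def cutoff (x : ℝ) : GradSpace :=
  indicatorConstLp 2 (measurableSet_Icc (a := (0 : ℝ)) (b := x)) (measure_ne_top _ _) 1

open Classical in
/-- The primitive of `g`, set to zero outside `(0,1)`. -/
def prim : GradSpace →ₗ[ℝ] (ℝ → ℝ) where
  toFun g x := if x ∈ Ioo (0 : ℝ) 1 then ⟪cutoff x, g⟫_ℝ else 0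
  map_add' g h := by
    funext x
    rw [Pi.add_apply]
    split_ifs <;> simp [inner_add_right]
  map_smul' c g := by
    funext x
    rw [Pi.smul_apply]
    split_ifs <;> simp [inner_smul_right]

/-- The functions in `L²([0,1])` with mean zero. -/
def meanZero : Submodule ℝ GradSpace := (Submodule.span ℝ {cutoff 1})ᗮ

theorem mem_meanZero {g : GradSpace} : g ∈ meanZero ↔ ⟪cutoff 1, g⟫_ℝ = 0 := by
  rw [meanZero, Submodule.mem_orthogonal_singleton_iff_inner_right]

theorem prim_apply {x : ℝ} (hx : x ∈ Ioo (0 : ℝ) 1) (g : GradSpace) :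
    prim g x = ⟪cutoff x, g⟫_ℝ := by
  simp [prim, hx.1, hx.2]

theorem prim_of_notMem {x : ℝ} (hx : x ∉ Ioo (0 : ℝ) 1) (g : GradSpace) : prim g x = 0 :=
  if_neg hx

theorem integrableOn_gradSpace (g : GradSpace) : IntegrableOn g (Icc 0 1) :=
  (Lp.memLp g).integrable one_le_two

theorem intervalIntegrable_of_integrableOn {g : ℝ → ℝ} (hg : IntegrableOn g (Icc 0 1)) {a b : ℝ}
    (ha : a ∈ Icc (0 : ℝ) 1) (hb : b ∈ Icc (0 : ℝ) 1) : IntervalIntegrable g volume a b := by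
  rw [intervalIntegrable_iff]
  refine hg.mono_set fun t ht => ?_
  rw [mem_uIoc] at ht
  rcases ht with h | h
  · exact ⟨ha.1.trans h.1.le, h.2.trans hb.2⟩
  · exact ⟨hb.1.trans h.1.le, h.2.trans ha.2⟩

theorem setIntegral_Icc_eq_interval (g : ℝ → ℝ) {x : ℝ} (hx : 0 ≤ x) :
    ∫ t in Icc 0 x, g t = ∫ t in (0 : ℝ)..x, g t := by
  rw [intervalIntegral.integral_of_le hx, integral_Icc_eq_integral_Ioc]

theorem inner_cutoff (g : GradSpace) {x : ℝ} (hx : x ∈ Icc (0 : ℝ) 1) :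
    ⟪cutoff x, g⟫_ℝ = ∫ t in (0 : ℝ)..x, g t := by
  rw [cutoff, L2.inner_indicatorConstLp_one, Measure.restrict_restrict measurableSet_Icc,
    inter_eq_left.2 (Icc_subset_Icc_right hx.2), setIntegral_Icc_eq_interval g hx.1]

theorem prim_eq_integral {g : GradSpace} (hg : g ∈ meanZero) {x : ℝ} (hx : x ∈ Icc (0 : ℝ) 1) :
    prim g x = ∫ t in (0 : ℝ)..x, g t := by
  by_cases h : x ∈ Ioo (0 : ℝ) 1
  · rw [prim_apply h, inner_cutoff g hx]
  · rw [prim_of_notMem h]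
    rcases hx.1.eq_or_lt with h0 | h0
    · simp [← h0]
    · have h1 : x = 1 := le_antisymm hx.2 (not_lt.1 fun h1 => h ⟨h0, h1⟩)
      rw [h1, ← inner_cutoff g ⟨zero_le_one, le_rfl⟩, mem_meanZero.1 hg]

theorem prim_sub_prim {g : GradSpace} (hg : g ∈ meanZero) {a b : ℝ} (ha : a ∈ Icc (0 : ℝ) 1)
    (hb : b ∈ Icc (0 : ℝ) 1) : prim g b - prim g a = ∫ t in a..b, g t := by
  have h0 : (0 : ℝ) ∈ Icc (0 : ℝ) 1 := ⟨le_rfl, zero_le_one⟩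
  rw [prim_eq_integral hg ha, prim_eq_integral hg hb]
  exact intervalIntegral.integral_interval_sub_left
    (intervalIntegrable_of_integrableOn (integrableOn_gradSpace g) h0 hb)
    (intervalIntegrable_of_integrableOn (integrableOn_gradSpace g) h0 ha)

/-- By Lebesgue differentiation, `g` is almost everywhere the derivative of its primitive. -/
theorem ae_eq_zero_of_forall_integral_eq_zero {g : ℝ → ℝ} (hg : IntegrableOn g (Icc 0 1))
    (h : ∀ x ∈ Icc (0 : ℝ) 1, ∫ t in (0 : ℝ)..x, g t = 0) :
    g =ᵐ[volume.restrict (Icc 0 1)] 0 := by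
  have h0 : (0 : ℝ) ∈ Icc (0 : ℝ) 1 := ⟨le_rfl, zero_le_one⟩
  have h1 : (1 : ℝ) ∈ Icc (0 : ℝ) 1 := ⟨zero_le_one, le_rfl⟩
  have hi : IntervalIntegrable g volume 0 1 := intervalIntegrable_of_integrableOn hg h0 h1
  have hd := hi.ae_hasDerivAt_integral
  rw [Filter.EventuallyEq, ← restrict_Ioo_eq_restrict_Icc, ae_restrict_iff' measurableSet_Ioo]
  filter_upwards [hd] with x hx hxI
  have hx' : x ∈ uIcc (0 : ℝ) 1 := by
    rw [uIcc_of_le zero_le_one]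
    exact Ioo_subset_Icc_self hxI
  have hder := hx hx' 0 (by simp)
  have hz : HasDerivAt (fun y => ∫ t in (0 : ℝ)..y, g t) 0 x := by
    refine (hasDerivAt_const x (0 : ℝ)).congr_of_eventuallyEq ?_
    filter_upwards [isOpen_Ioo.mem_nhds hxI] with y hy
    exact h y (Ioo_subset_Icc_self hy)
  exact hder.unique hz

theorem eq_zero_of_prim_eq_zero {g : GradSpace} (hg : g ∈ meanZero) (h : prim g = 0) : g = 0 := by
  refine (Lp.eq_zero_iff_ae_eq_zero).2
    (ae_eq_zero_of_forall_integral_eq_zero (integrableOn_gradSpace g) fun x hx => ?_)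
  rw [← prim_eq_integral hg hx, h]
  rfl

theorem HasGrad.ae_eq {f g h : ℝ → ℝ} (hg : HasGrad f g) (hh : HasGrad f h) :
    g =ᵐ[volume.restrict (Icc 0 1)] h := by
  have hgi : IntegrableOn g (Icc 0 1) := hg.1.integrable one_le_two
  have hhi : IntegrableOn h (Icc 0 1) := hh.1.integrable one_le_two
  have h0 : (0 : ℝ) ∈ Icc (0 : ℝ) 1 := ⟨le_rfl, zero_le_one⟩
  have := ae_eq_zero_of_forall_integral_eq_zero (hgi.sub hhi) fun x hx => by
    have e := (hg.2 x hx).symm.trans (hh.2 x hx)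
    rw [setIntegral_Icc_eq_interval g hx.1, setIntegral_Icc_eq_interval h hx.1] at e
    simp only [Pi.sub_apply]
    rw [intervalIntegral.integral_sub (intervalIntegrable_of_integrableOn hgi h0 hx)
      (intervalIntegrable_of_integrableOn hhi h0 hx)]
    linarith
  filter_upwards [this] with x hx
  simpa [sub_eq_zero] using hx

theorem hasGrad_prim {g : GradSpace} (hg : g ∈ meanZero) : HasGrad (prim g) g := by
  refine ⟨Lp.memLp g, fun x hx => ?_⟩
  rw [prim_of_notMem (x := 0) (by simp), zero_add, setIntegral_Icc_eq_interval _ hx.1,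
    prim_eq_integral hg hx]

theorem hasGrad_grad {f : ℝ → ℝ} (h : ∃ g, HasGrad f g) : HasGrad f (grad f) := by
  rw [grad, dif_pos h]
  exact h.choose_spec

theorem grad_prim {g : GradSpace} (hg : g ∈ meanZero) :
    grad (prim g) =ᵐ[volume.restrict (Icc 0 1)] g :=
  (hasGrad_grad ⟨_, hasGrad_prim hg⟩).ae_eq (hasGrad_prim hg)

theorem prim_mem_H10 {g : GradSpace} (hg : g ∈ meanZero) : prim g ∈ H10 :=
  ⟨⟨_, hasGrad_prim hg⟩, fun _ hx => prim_of_notMem hx g⟩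

/-- The boundary condition at `1` is exactly the mean zero condition on the derivative. -/
theorem exists_prim_eq_of_mem_H10 {f : ℝ → ℝ} (hf : f ∈ H10) : ∃ g ∈ meanZero, prim g = f := by
  obtain ⟨⟨g, hgm, hg⟩, hf0⟩ := hf
  have h0 : (0 : ℝ) ∈ Icc (0 : ℝ) 1 := ⟨le_rfl, zero_le_one⟩
  have h1 : (1 : ℝ) ∈ Icc (0 : ℝ) 1 := ⟨zero_le_one, le_rfl⟩
  have hfz : f 0 = 0 := hf0 0 (by simp)
  have key : ∀ x ∈ Icc (0 : ℝ) 1, ⟪cutoff x, hgm.toLp g⟫_ℝ = f x := by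
    intro x hx
    rw [inner_cutoff _ hx, hg x hx, hfz, zero_add, setIntegral_Icc_eq_interval _ hx.1,
      intervalIntegral.integral_of_le hx.1, intervalIntegral.integral_of_le hx.1]
    refine integral_congr_ae ?_
    exact ae_restrict_of_ae_restrict_of_subset
      (Ioc_subset_Icc_self.trans (Icc_subset_Icc_right hx.2)) hgm.coeFn_toLp
  refine ⟨hgm.toLp g, mem_meanZero.2 ?_, ?_⟩
  · rw [key 1 h1, hf0 1 (by simp)]
  · funext x
    by_cases hx : x ∈ Ioo (0 : ℝ) 1
    · rw [prim_apply hx, key x (Ioo_subset_Icc_self hx)]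
    · rw [prim_of_notMem hx, hf0 x hx]

theorem form_prim {g h : GradSpace} (hg : g ∈ meanZero) (hh : h ∈ meanZero) :
    form (prim g) (prim h) = ⟪g, h⟫_ℝ := by
  rw [form, restrict_Ioo_eq_restrict_Icc, L2.inner_def]
  refine integral_congr_ae ?_
  filter_upwards [grad_prim hg, grad_prim hh] with x h1 h2
  rw [h1, h2]
  simp [mul_comm]

theorem continuousOn_prim {g : GradSpace} (hg : g ∈ meanZero) :
    ContinuousOn (prim g) (Icc 0 1) := by
  have : ContinuousOn (fun x => ∫ t in (0 : ℝ)..x, g t) (uIcc 0 1) := by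
    refine intervalIntegral.continuousOn_primitive_interval ?_
    rw [uIcc_of_le zero_le_one]
    exact integrableOn_gradSpace g
  rw [uIcc_of_le zero_le_one] at this
  exact this.congr fun x hx => prim_eq_integral hg hx

theorem norm_cutoff_le {x : ℝ} : ‖cutoff x‖ ≤ 1 := by
  refine norm_indicatorConstLp_le.trans ?_
  rw [norm_one, one_mul]
  refine Real.rpow_le_one measureReal_nonneg ?_ (by positivity)
  refine (measureReal_mono (subset_univ _)).trans ?_
  simp

theorem abs_prim_le (g : GradSpace) (x : ℝ) : |prim g x| ≤ ‖g‖ := by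
  by_cases hx : x ∈ Ioo (0 : ℝ) 1
  · rw [prim_apply hx]
    refine (abs_real_inner_le_norm _ _).trans ?_
    exact mul_le_of_le_one_left (norm_nonneg _) norm_cutoff_le
  · rw [prim_of_notMem hx, abs_zero]
    exact norm_nonneg _

theorem measurable_prim {g : GradSpace} (hg : g ∈ meanZero) : Measurable (prim g) := by
  have hc : ContinuousOn (prim g) (Ioo 0 1) := (continuousOn_prim hg).mono Ioo_subset_Icc_self
  have : prim g = (Ioo (0 : ℝ) 1).indicator (prim g) := by
    funext x
    by_cases hx : x ∈ Ioo (0 : ℝ) 1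
    · rw [indicator_of_mem hx]
    · rw [indicator_of_notMem hx, prim_of_notMem hx]
  rw [this]
  classical
  rw [← piecewise_eq_indicator]
  exact hc.measurable_piecewise continuousOn_const measurableSet_Ioo

/-! ### The form domain as an orthogonal complement -/

theorem inner_cutoff_eq_prim {g : GradSpace} (hg : g ∈ meanZero) {x : ℝ}
    (hx : x ∈ Icc (0 : ℝ) 1) : ⟪cutoff x, g⟫_ℝ = prim g x := by
  rw [inner_cutoff g hx, prim_eq_integral hg hx]

/-- Since `cutoff x` represents evaluation at `x`, this kernel reduces all computations with
piecewise linear functions to arithmetic with `min`. -/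
theorem inner_cutoff_cutoff {x y : ℝ} (hx : x ∈ Icc (0 : ℝ) 1) (hy : y ∈ Icc (0 : ℝ) 1) :
    ⟪cutoff x, cutoff y⟫_ℝ = min x y := by
  have h : Icc 0 x ∩ Icc 0 y ∩ Icc (0 : ℝ) 1 = Icc 0 (min x y) := by
    rw [Icc_inter_Icc, Icc_inter_Icc]
    simp [hx.2]
  rw [cutoff, cutoff, L2.real_inner_indicatorConstLp_one_indicatorConstLp_one,
    measureReal_restrict_apply (measurableSet_Icc.inter measurableSet_Icc), h,
    Real.volume_real_Icc_of_le (le_min hx.1 hy.1), sub_zero]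

section FormDomain

variable (ν : Measure ℝ)

/-- The mean zero functions whose primitive vanishes on the support of `ν`. -/
def nullSpace : Submodule ℝ GradSpace :=
  (Submodule.span ℝ (cutoff '' (ν.support ∩ Ioo 0 1 ∪ {1})))ᗮ

/-- The weak derivatives of the elements of `dom ν`. -/
def gradDom : Submodule ℝ GradSpace := meanZero ⊓ (nullSpace ν)ᗮ

instance : (nullSpace ν).HasOrthogonalProjection := by
  unfold nullSpace
  infer_instance

instance : (gradDom ν).HasOrthogonalProjection := by
  have h : IsClosed ((gradDom ν : Submodule ℝ GradSpace) : Set GradSpace) := by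
    rw [gradDom, Submodule.coe_inf]
    refine IsClosed.inter ?_ (Submodule.isClosed_orthogonal _)
    exact Submodule.isClosed_orthogonal _
  have : CompleteSpace (gradDom ν) := h.completeSpace_coe
  infer_instance

variable {ν}

theorem mem_nullSpace {g : GradSpace} :
    g ∈ nullSpace ν ↔ g ∈ meanZero ∧ ∀ x ∈ ν.support, prim g x = 0 := by
  rw [nullSpace, Submodule.mem_orthogonal']
  constructor
  · intro h
    have h' : ∀ x ∈ ν.support ∩ Ioo 0 1 ∪ {1}, ⟪cutoff x, g⟫_ℝ = 0 := fun x hx => by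
      rw [real_inner_comm]
      exact h _ (Submodule.subset_span (mem_image_of_mem _ hx))
    refine ⟨mem_meanZero.2 (h' 1 (by simp)), fun x hx => ?_⟩
    by_cases hx1 : x ∈ Ioo (0 : ℝ) 1
    · rw [prim_apply hx1, h' x (Or.inl ⟨hx, hx1⟩)]
    · exact prim_of_notMem hx1 g
  · rintro ⟨h1, h2⟩ u hu
    refine Submodule.span_induction (p := fun u _ => ⟪g, u⟫_ℝ = 0) ?_ ?_ ?_ ?_ hu
    · rintro _ ⟨x, hx | rfl, rfl⟩
      · rw [real_inner_comm, ← prim_apply hx.2, h2 x hx.1]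
      · rw [real_inner_comm, mem_meanZero.1 h1]
    · simp
    · intro a b _ _ ha hb
      rw [inner_add_right, ha, hb, add_zero]
    · intro c a _ ha
      rw [inner_smul_right, ha, mul_zero]

/-- `meanZero` is the orthogonal sum of `gradDom ν` and `nullSpace ν`. Hence projecting onto the
form domain changes no value on the support of `ν`. -/
theorem sub_starProjection_gradDom_mem {g : GradSpace} (hg : g ∈ meanZero) :
    g - (gradDom ν).starProjection g ∈ nullSpace ν := by
  have h : (gradDom ν).starProjection g = g - (nullSpace ν).starProjection g := by
    refine Submodule.eq_starProjection_of_mem_orthogonal (K := gradDom ν) ?_ ?_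
    · exact ⟨meanZero.sub_mem hg (mem_nullSpace.1 (Submodule.starProjection_apply_mem _ g)).1,
        Submodule.sub_starProjection_mem_orthogonal g⟩
    · rw [sub_sub_cancel, Submodule.mem_orthogonal']
      intro u hu
      exact (Submodule.mem_orthogonal _ _).1 hu.2 _ (Submodule.starProjection_apply_mem _ g)
  rw [h, sub_sub_cancel]
  exact Submodule.starProjection_apply_mem _ g

theorem starProjection_gradDom_mem_meanZero (g : GradSpace) :
    (gradDom ν).starProjection g ∈ meanZero :=
  (Submodule.starProjection_apply_mem (gradDom ν) g).1

theorem prim_starProjection_gradDom {g : GradSpace} (hg : g ∈ meanZero) {x : ℝ}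
    (hx : x ∈ ν.support) : prim ((gradDom ν).starProjection g) x = prim g x := by
  have := (mem_nullSpace.1 (sub_starProjection_gradDom_mem (ν := ν) hg)).2 x hx
  rw [map_sub, Pi.sub_apply, sub_eq_zero] at this
  exact this.symm

theorem prim_affine_of_mem_gradDom {g : GradSpace} (hg : g ∈ gradDom ν) {a b : ℝ}
    (ha : 0 ≤ a) (hb : b ≤ 1) (hν : Disjoint (Ioo a b) ν.support) {y : ℝ} (hy : y ∈ Icc a b) :
    (b - a) * prim g y = (y - a) * prim g b + (b - y) * prim g a := by
  have haI : a ∈ Icc (0 : ℝ) 1 := ⟨ha, (hy.1.trans hy.2).trans hb⟩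
  have hbI : b ∈ Icc (0 : ℝ) 1 := ⟨(ha.trans hy.1).trans hy.2, hb⟩
  have hyI : y ∈ Icc (0 : ℝ) 1 := ⟨ha.trans hy.1, hy.2.trans hb⟩
  -- The primitive of `k` is a tent over `[a,b]` with its peak at `y`. It vanishes on the support,
  -- so `k` lies in `nullSpace ν`, and orthogonality of `g` to `k` is the interpolation identity.
  set k : GradSpace := (b - a) • cutoff y - (y - a) • cutoff b - (b - y) • cutoff a with hk
  have hkx : ∀ x ∈ Icc (0 : ℝ) 1, x ∉ Ioo a b → ⟪cutoff x, k⟫_ℝ = 0 := by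
    intro x hx hxab
    rw [hk, inner_sub_right, inner_sub_right, inner_smul_right, inner_smul_right,
      inner_smul_right, inner_cutoff_cutoff hx hyI, inner_cutoff_cutoff hx hbI,
      inner_cutoff_cutoff hx haI]
    rcases le_or_gt x a with h | h
    · rw [min_eq_left h, min_eq_left (h.trans hy.1), min_eq_left ((h.trans hy.1).trans hy.2)]
      ring
    · have h' : b ≤ x := not_lt.1 fun h' => hxab ⟨h, h'⟩
      rw [min_eq_right h', min_eq_right (hy.2.trans h'), min_eq_right h.le]
      ring
  have hkm : k ∈ meanZero := mem_meanZero.2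
    (hkx 1 ⟨zero_le_one, le_rfl⟩ fun h => (h.2.trans_le hb).false)
  have hkK : k ∈ nullSpace ν := mem_nullSpace.2 ⟨hkm, fun x hx => by
    by_cases hx1 : x ∈ Ioo (0 : ℝ) 1
    · rw [prim_apply hx1]
      exact hkx x (Ioo_subset_Icc_self hx1) fun h => disjoint_left.1 hν h hx
    · exact prim_of_notMem hx1 k⟩
  have h0 := (Submodule.mem_orthogonal _ _).1 hg.2 k hkK
  rw [hk, inner_sub_left, inner_sub_left, real_inner_smul_left, real_inner_smul_left,
    real_inner_smul_left, inner_cutoff_eq_prim hg.1 hyI, inner_cutoff_eq_prim hg.1 hbI,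
    inner_cutoff_eq_prim hg.1 haI] at h0
  linarith

theorem prim_mem_Cnu {g : GradSpace} (hg : g ∈ gradDom ν) : prim g ∈ Cnu ν := by
  refine ⟨continuousOn_prim hg.1, fun x hx => ?_⟩
  set S := connectedComponentIn (Icc (0 : ℝ) 1 \ ν.support) x with hS
  have hSU : S ⊆ Icc (0 : ℝ) 1 \ ν.support := connectedComponentIn_subset _ _
  have hxS : x ∈ S := mem_connectedComponentIn hx
  have hord : S.OrdConnected := isPreconnected_connectedComponentIn.ordConnected
  have hbb : BddBelow S := ⟨0, fun y hy => (hSU hy).1.1⟩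
  have hba : BddAbove S := ⟨1, fun y hy => (hSU hy).1.2⟩
  have ha0 : 0 ≤ sInf S := le_csInf ⟨x, hxS⟩ fun y hy => (hSU hy).1.1
  have hb1 : sSup S ≤ 1 := csSup_le ⟨x, hxS⟩ fun y hy => (hSU hy).1.2
  have hIoo : Disjoint (Ioo (sInf S) (sSup S)) ν.support := by
    rw [disjoint_left]
    intro y hy
    obtain ⟨s, hs, hsy⟩ := exists_lt_of_csInf_lt ⟨x, hxS⟩ hy.1
    obtain ⟨s', hs', hys'⟩ := exists_lt_of_lt_csSup ⟨x, hxS⟩ hy.2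
    exact (hSU (hord.out hs hs' ⟨hsy.le, hys'.le⟩)).2
  have haff : ∀ y ∈ S, _ := fun y hy =>
    prim_affine_of_mem_gradDom hg ha0 hb1 hIoo ⟨csInf_le hbb hy, le_csSup hba hy⟩
  set a := sInf S
  set b := sSup S
  rcases ((csInf_le hbb hxS).trans (le_csSup hba hxS) : a ≤ b).eq_or_lt with hab | hab
  · refine ⟨0, prim g a, fun y hy => ?_⟩
    have : y = a := le_antisymm ((le_csSup hba hy).trans hab.ge) (csInf_le hbb hy)
    rw [this]
    ring
  · have hne : b - a ≠ 0 := sub_ne_zero.2 hab.ne'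
    refine ⟨(prim g b - prim g a) / (b - a), (b * prim g a - a * prim g b) / (b - a),
      fun y hy => ?_⟩
    rw [div_mul_eq_mul_div, ← add_div, eq_div_iff hne, mul_comm, haff y hy]
    ring

/-- A function in `Cnu ν` that vanishes at the boundary and on the support of `ν` is zero. -/
theorem eq_zero_of_mem_Cnu {f : ℝ → ℝ} (hf : f ∈ Cnu ν)
    (h0 : ∀ x, x ∉ Ioo (0 : ℝ) 1 → f x = 0) (hz : ∀ x ∈ ν.support, f x = 0) : f = 0 := by
  funext x
  by_cases hx : x ∈ Ioo (0 : ℝ) 1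
  swap
  · exact h0 x hx
  by_cases hxs : x ∈ ν.support
  · exact hz x hxs
  have hcl : IsClosed ν.support := Measure.isClosed_support
  -- The gap around `x` runs between the nearest points of the support on either side; adjoining `0`
  -- and `1` guarantees that both exist. An affine function vanishing at both ends of the gap is
  -- zero.
  have hclA : IsClosed ((ν.support ∪ {0}) ∩ Icc 0 x) :=
    (hcl.union isClosed_singleton).inter isClosed_Icc
  have hclB : IsClosed ((ν.support ∪ {1}) ∩ Icc x 1) :=
    (hcl.union isClosed_singleton).inter isClosed_Icc
  have hneA : ((ν.support ∪ {0}) ∩ Icc 0 x).Nonempty := ⟨0, Or.inr rfl, le_rfl, hx.1.le⟩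
  have hneB : ((ν.support ∪ {1}) ∩ Icc x 1).Nonempty := ⟨1, Or.inr rfl, hx.2.le, le_rfl⟩
  have hbA : BddAbove ((ν.support ∪ {0}) ∩ Icc 0 x) := ⟨x, fun y hy => hy.2.2⟩
  have hbB : BddBelow ((ν.support ∪ {1}) ∩ Icc x 1) := ⟨x, fun y hy => hy.2.1⟩
  have hmA := hclA.csSup_mem hneA hbA
  have hmB := hclB.csInf_mem hneB hbB
  set a := sSup ((ν.support ∪ {0}) ∩ Icc 0 x)
  set b := sInf ((ν.support ∪ {1}) ∩ Icc x 1)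
  have hfa : f a = 0 := by
    rcases hmA.1 with h | h
    · exact hz a h
    · exact h0 a (by rw [mem_singleton_iff.1 h]; simp)
  have hfb : f b = 0 := by
    rcases hmB.1 with h | h
    · exact hz b h
    · exact h0 b (by rw [mem_singleton_iff.1 h]; simp)
  have hax : a < x := lt_of_le_of_ne hmA.2.2 fun h => by
    rcases hmA.1 with h' | h'
    · exact hxs (h ▸ h')
    · exact hx.1.ne (h ▸ (mem_singleton_iff.1 h').symm)
  have hxb : x < b := lt_of_le_of_ne hmB.2.1 fun h => by
    rcases hmB.1 with h' | h'
    · exact hxs (h ▸ h')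
    · exact hx.2.ne (h.trans (mem_singleton_iff.1 h'))
  have hsub : Ioo a b ⊆ Icc (0 : ℝ) 1 \ ν.support := by
    intro y hy
    have hy1 : y ∈ Icc (0 : ℝ) 1 := ⟨hmA.2.1.trans hy.1.le, hy.2.le.trans hmB.2.2⟩
    refine ⟨hy1, fun hys => ?_⟩
    rcases le_total y x with h | h
    · exact (hy.1.trans_le (le_csSup hbA ⟨Or.inl hys, hy1.1, h⟩)).false
    · exact ((csInf_le hbB ⟨Or.inl hys, h, hy1.2⟩).trans_lt hy.2).false
  obtain ⟨c, d, hcd⟩ := hf.2 x (hsub ⟨hax, hxb⟩)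
  have hcd' : ∀ y ∈ Ioo a b, f y = c * y + d := fun y hy =>
    hcd y (isPreconnected_Ioo.subset_connectedComponentIn ⟨hax, hxb⟩ hsub hy)
  have hab : a < b := hax.trans hxb
  have hcont : ContinuousOn f (Icc a b) :=
    hf.1.mono fun y hy => ⟨hmA.2.1.trans hy.1, hy.2.trans hmB.2.2⟩
  have hcl' : ∀ y ∈ Icc a b, f y = c * y + d := by
    have : EqOn f (fun y => c * y + d) (closure (Ioo a b)) := by
      refine EqOn.of_subset_closure (s := Ioo a b) hcd' ?_ ?_ subset_closure subset_rfl
      · rwa [closure_Ioo hab.ne]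
      · fun_prop
    rwa [closure_Ioo hab.ne] at this
  have e1 := hcl' a ⟨le_rfl, hab.le⟩
  have e2 := hcl' b ⟨hab.le, le_rfl⟩
  rw [hfa] at e1
  rw [hfb] at e2
  have hc0 : c = 0 := by
    have : c * (b - a) = 0 := by linarith
    exact (mul_eq_zero.1 this).resolve_right (sub_ne_zero.2 hab.ne')
  have := hcl' x ⟨hax.le, hxb.le⟩
  rw [this, Pi.zero_apply]
  rw [hc0] at e1 ⊢
  linarith

theorem Cnu.sub_mem {f g : ℝ → ℝ} (hf : f ∈ Cnu ν) (hg : g ∈ Cnu ν) : f - g ∈ Cnu ν := by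
  refine ⟨hf.1.sub hg.1, fun x hx => ?_⟩
  obtain ⟨c, d, h⟩ := hf.2 x hx
  obtain ⟨c', d', h'⟩ := hg.2 x hx
  refine ⟨c - c', d - d', fun y hy => ?_⟩
  rw [Pi.sub_apply, h y hy, h' y hy]
  ring

/-- A function of the domain and the primitive of its projected derivative agree on the support and
are both affine on the gaps, so they coincide. -/
theorem dom_eq_image_prim : dom ν = prim '' (gradDom ν) := by
  ext f
  constructor
  · rintro ⟨hf, hfC⟩
    obtain ⟨g, hg, rfl⟩ := exists_prim_eq_of_mem_H10 hf
    refine ⟨g, ?_, rfl⟩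
    have hK := sub_starProjection_gradDom_mem (ν := ν) hg
    have hmem := Submodule.starProjection_apply_mem (gradDom ν) g
    have hz : prim (g - (gradDom ν).starProjection g) = 0 := by
      refine eq_zero_of_mem_Cnu ?_ (fun x hx => prim_of_notMem hx _)
        (mem_nullSpace.1 hK).2
      rw [map_sub]
      exact Cnu.sub_mem hfC (prim_mem_Cnu hmem)
    have := eq_zero_of_prim_eq_zero (mem_nullSpace.1 hK).1 hz
    rw [sub_eq_zero] at this
    rw [this]
    exact hmem
  · rintro ⟨g, hg, rfl⟩
    exact ⟨prim_mem_H10 hg.1, prim_mem_Cnu hg⟩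

end FormDomain

/-! ### Dyadic estimate of the `L²(ν)`-norm -/

theorem integrableOn_sq_gradSpace (g : GradSpace) :
    IntegrableOn (fun t => g t ^ 2) (Icc 0 1) :=
  (Lp.memLp g).integrable_sq

theorem setIntegral_sq_eq_norm_sq (g : GradSpace) : ∫ t in Icc (0 : ℝ) 1, g t ^ 2 = ‖g‖ ^ 2 := by
  rw [← real_inner_self_eq_norm_sq, L2.inner_def]
  refine integral_congr_ae (Eventually.of_forall fun t => ?_)
  simp

/-- Cauchy-Schwarz, obtained by expanding the nonnegative integral of `(g - c)²` with `c` the mean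
of `g`. -/
theorem sq_setIntegral_le {g : ℝ → ℝ} {a b : ℝ} (hab : a < b) (hg : IntegrableOn g (Ioc a b))
    (hg2 : IntegrableOn (fun t => g t ^ 2) (Ioc a b)) :
    (∫ t in Ioc a b, g t) ^ 2 ≤ (b - a) * ∫ t in Ioc a b, g t ^ 2 := by
  set A := ∫ t in Ioc a b, g t with hA
  set c := A / (b - a) with hc
  have hl : 0 < b - a := sub_pos.2 hab
  have h0 : 0 ≤ ∫ t in Ioc a b, (g t - c) ^ 2 := integral_nonneg fun t => sq_nonneg _
  have h1 : ∫ t in Ioc a b, (g t - c) ^ 2 =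
      (∫ t in Ioc a b, g t ^ 2) - 2 * c * A + c ^ 2 * (b - a) := by
    have e : ∀ t, (g t - c) ^ 2 = g t ^ 2 - 2 * c * g t + c ^ 2 := fun t => by ring
    simp_rw [e]
    have hi1 : IntegrableOn (fun t => 2 * c * g t) (Ioc a b) := hg.const_mul _
    have hi2 : IntegrableOn (fun t => g t ^ 2 - 2 * c * g t) (Ioc a b) := hg2.sub hi1
    rw [integral_add hi2 (integrable_const _), integral_sub hg2 hi1,
      integral_const_mul, integral_const]
    simp [hab.le]
    ring
  rw [h1] at h0
  have h2 : 2 * c * A = 2 * (A ^ 2 / (b - a)) := by rw [hc]; ring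
  have h3 : c ^ 2 * (b - a) = A ^ 2 / (b - a) := by rw [hc]; field_simp
  rw [h2, h3] at h0
  have h4 : A ^ 2 / (b - a) ≤ ∫ t in Ioc a b, g t ^ 2 := by linarith
  rwa [div_le_iff₀ hl, mul_comm] at h4

section Dyadic

variable {ν : Measure ℝ} [IsFiniteMeasure ν]

theorem integrable_prim_mul_prim {g h : GradSpace} (hg : g ∈ meanZero) (hh : h ∈ meanZero) :
    Integrable (fun x => prim g x * prim h x) ν := by
  refine Integrable.of_bound ((measurable_prim hg).mul (measurable_prim hh)).aestronglyMeasurable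
    (‖g‖ * ‖h‖) (Eventually.of_forall fun x => ?_)
  rw [norm_mul]
  exact mul_le_mul (abs_prim_le g x) (abs_prim_le h x) (norm_nonneg _) (norm_nonneg _)

theorem setIntegral_prim_sq_le {g : GradSpace} (hg : g ∈ meanZero) {a b : ℝ} (ha : 0 ≤ a)
    (hb : b ≤ 1) (hga : prim g a = 0) :
    ∫ x in Ioc a b, prim g x ^ 2 ∂ν ≤
      ν.real (Ioc a b) * (b - a) * ∫ t in Ioc a b, g t ^ 2 := by
  have hsub : Ioc a b ⊆ Icc 0 1 := fun t ht => ⟨ha.trans ht.1.le, ht.2.trans hb⟩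
  have hi : IntegrableOn (fun t => g t ^ 2) (Ioc a b) :=
    (integrableOn_sq_gradSpace g).mono_set hsub
  have hpt : ∀ x ∈ Ioc a b, prim g x ^ 2 ≤ (b - a) * ∫ t in Ioc a b, g t ^ 2 := by
    intro x hx
    have haI : a ∈ Icc (0 : ℝ) 1 := ⟨ha, (hx.1.le.trans hx.2).trans hb⟩
    have h1 := prim_sub_prim hg haI (hsub hx)
    rw [hga, sub_zero, intervalIntegral.integral_of_le hx.1.le] at h1
    have hsub' : Ioc a x ⊆ Ioc a b := Ioc_subset_Ioc_right hx.2
    rw [h1]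
    refine (sq_setIntegral_le hx.1 ((integrableOn_gradSpace g).mono_set (hsub'.trans hsub))
      (hi.mono_set hsub')).trans ?_
    have h2 : ∫ t in Ioc a x, g t ^ 2 ≤ ∫ t in Ioc a b, g t ^ 2 :=
      setIntegral_mono_set hi (Eventually.of_forall fun t => sq_nonneg _) hsub'.eventuallyLE
    exact mul_le_mul (by linarith [hx.2]) h2 (integral_nonneg fun t => sq_nonneg _)
      (by linarith [hx.1, hx.2])
  calc ∫ x in Ioc a b, prim g x ^ 2 ∂ν
      ≤ ∫ x in Ioc a b, (b - a) * (∫ t in Ioc a b, g t ^ 2) ∂ν := by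
        refine setIntegral_mono_on ?_ (integrable_const _) measurableSet_Ioc hpt
        have := integrable_prim_mul_prim (ν := ν) hg hg
        simp_rw [← sq] at this
        exact this.integrableOn
    _ = _ := by
        rw [setIntegral_const]
        simp only [smul_eq_mul]
        ring

theorem dyadic_succ (n k : ℕ) :
    dyadic n k = dyadic (n + 1) (2 * k) ∪ dyadic (n + 1) (2 * k + 1) := by
  have h2 : (0 : ℝ) < 2 ^ n := by positivity
  have e1 : ((2 * k : ℕ) : ℝ) / 2 ^ (n + 1) = k / 2 ^ n := by
    push_cast
    rw [pow_succ]
    field_simp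
  have e2 : (((2 * k + 1 : ℕ) : ℝ) + 1) / 2 ^ (n + 1) = ((k : ℝ) + 1) / 2 ^ n := by
    push_cast
    rw [pow_succ]
    field_simp
    ring
  have e3 : (((2 * k + 1 : ℕ) : ℝ)) / 2 ^ (n + 1) = (((2 * k : ℕ) : ℝ) + 1) / 2 ^ (n + 1) := by
    push_cast
    rfl
  unfold dyadic
  rw [e1, e2, e3, Ioc_union_Ioc_eq_Ioc]
  · rw [← e1]
    gcongr
    linarith
  · rw [← e2, ← e3]
    gcongr
    linarith

theorem disjoint_dyadic {n k l : ℕ} (h : k ≠ l) : Disjoint (dyadic n k) (dyadic n l) := by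
  wlog hkl : k < l generalizing k l
  · exact (this h.symm (lt_of_le_of_ne (not_lt.1 hkl) h.symm)).symm
  rw [disjoint_left]
  intro x hx hx'
  have : ((k : ℝ) + 1) / 2 ^ n ≤ (l : ℝ) / 2 ^ n := by
    gcongr
    exact_mod_cast hkl
  exact (hx'.1.trans_le (hx.2.trans this)).false

theorem measurableSet_dyadic (n k : ℕ) : MeasurableSet (dyadic n k) := measurableSet_Ioc

theorem dyadic_subset_Icc {n k : ℕ} (hk : k < 2 ^ n) : dyadic n k ⊆ Icc 0 1 := by
  intro x hx
  have hk' : (k : ℝ) + 1 ≤ 2 ^ n := by exact_mod_cast hk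
  refine ⟨le_trans (by positivity) hx.1.le, hx.2.trans ?_⟩
  rw [div_le_one (by positivity)]
  exact hk'

open Classical in
/-- The indices `(n, k)` with `n < N` of the dyadic intervals `C` with `ν(C) |C| ≥ t`. -/
def heavy (ν : Measure ℝ) (t : ℝ) (N : ℕ) : Finset (Σ _ : ℕ, ℕ) :=
  (Finset.range N).sigma fun n =>
    (Finset.range (2 ^ n)).filter fun k => t ≤ ν.real (dyadic n k) / 2 ^ n

/-- The midpoint of a dyadic interval. -/
def midpt (p : Σ _ : ℕ, ℕ) : ℝ := ((2 * p.2 + 1 : ℕ) : ℝ) / 2 ^ (p.1 + 1)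

theorem midpt_mem {p : Σ _ : ℕ, ℕ} (hp : p.2 < 2 ^ p.1) : midpt p ∈ Ioo (0 : ℝ) 1 := by
  refine ⟨by unfold midpt; positivity, ?_⟩
  rw [midpt, div_lt_one (by positivity)]
  have : 2 * p.2 + 1 < 2 ^ (p.1 + 1) := by
    rw [pow_succ]
    omega
  exact_mod_cast this

theorem heavy_lt {ν : Measure ℝ} {t : ℝ} {N : ℕ} {p : Σ _ : ℕ, ℕ} (hp : p ∈ heavy ν t N) :
    p.2 < 2 ^ p.1 := by
  rw [heavy, Finset.mem_sigma, Finset.mem_filter, Finset.mem_range, Finset.mem_range] at hp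
  exact hp.2.1

/-- Stopping-time induction on the remaining depth `m`. A heavy interval is bisected: the left child
inherits the zero at its left endpoint, and the right child starts at the midpoint, where `prim g`
vanishes by `hz`. At a light interval the one-interval estimate applies, and by `hN` every interval
of level `N` is light. -/
theorem setIntegral_dyadic_prim_sq_le {g : GradSpace} (hg : g ∈ meanZero) {t : ℝ}
    {N : ℕ} (hN : ν.real univ / 2 ^ N < t) (hz : ∀ p ∈ heavy ν t N, prim g (midpt p) = 0) :
    ∀ m n k : ℕ, n + m = N → k < 2 ^ n → prim g ((k : ℝ) / 2 ^ n) = 0 →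
      ∫ x in dyadic n k, prim g x ^ 2 ∂ν ≤ t * ∫ x in dyadic n k, g x ^ 2 := by
  intro m
  induction m with
  | zero =>
    intro n k hn hk h0
    have hk' : (k : ℝ) + 1 ≤ 2 ^ n := by exact_mod_cast hk
    refine (setIntegral_prim_sq_le hg (by positivity) ?_ h0).trans ?_
    · rw [div_le_one (by positivity)]
      exact hk'
    · refine mul_le_mul_of_nonneg_right ?_ (integral_nonneg fun t => sq_nonneg _)
      rw [add_zero] at hn
      have e : ((k : ℝ) + 1) / 2 ^ n - k / 2 ^ n = (2 ^ n)⁻¹ := by ring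
      rw [e, ← div_eq_mul_inv, hn]
      refine le_trans ?_ hN.le
      gcongr
      · exact measure_ne_top _ _
      · exact subset_univ _
  | succ m ih =>
    intro n k hn hk h0
    have hk' : (k : ℝ) + 1 ≤ 2 ^ n := by exact_mod_cast hk
    by_cases hheavy : t ≤ ν.real (dyadic n k) / 2 ^ n
    · have hmem : (⟨n, k⟩ : Σ _ : ℕ, ℕ) ∈ heavy ν t N := by
        rw [heavy, Finset.mem_sigma, Finset.mem_filter, Finset.mem_range, Finset.mem_range]
        exact ⟨by simp only; omega, hk, hheavy⟩
      have hpow : 2 ^ (n + 1) = 2 * 2 ^ n := pow_succ' _ _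
      have e1 : ((2 * k : ℕ) : ℝ) / 2 ^ (n + 1) = k / 2 ^ n := by
        push_cast
        rw [pow_succ]
        field_simp
      have i1 := ih (n + 1) (2 * k) (by omega) (by omega) (by rw [e1, h0])
      have i2 := ih (n + 1) (2 * k + 1) (by omega) (by omega) (hz _ hmem)
      have hd : Disjoint (dyadic (n + 1) (2 * k)) (dyadic (n + 1) (2 * k + 1)) :=
        disjoint_dyadic (by omega)
      have hint : Integrable (fun x => prim g x ^ 2) ν := by
        have := integrable_prim_mul_prim (ν := ν) hg hg
        simp_rw [← sq] at this
        exact this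
      have hint2 : ∀ l < 2 ^ (n + 1), IntegrableOn (fun t => g t ^ 2) (dyadic (n + 1) l) :=
        fun l hl => (integrableOn_sq_gradSpace g).mono_set (dyadic_subset_Icc hl)
      rw [dyadic_succ, setIntegral_union hd (measurableSet_dyadic _ _) hint.integrableOn
        hint.integrableOn, setIntegral_union hd (measurableSet_dyadic _ _)
        (hint2 _ (by omega)) (hint2 _ (by omega)), mul_add]
      exact add_le_add i1 i2
    · refine (setIntegral_prim_sq_le hg (by positivity) ?_ h0).trans ?_
      · rw [div_le_one (by positivity)]
        exact hk'
      · refine mul_le_mul_of_nonneg_right ?_ (integral_nonneg fun t => sq_nonneg _)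
        have e : ((k : ℝ) + 1) / 2 ^ n - k / 2 ^ n = (2 ^ n)⁻¹ := by ring
        rw [e, ← div_eq_mul_inv]
        exact (not_le.1 hheavy).le

/-- If the primitive of `g` vanishes at the midpoints of all heavy intervals, its `L²(ν)`-norm is
controlled by the energy. -/
theorem integral_prim_sq_le {g : GradSpace} (hg : g ∈ meanZero) {t : ℝ}
    {N : ℕ} (hN : ν.real univ / 2 ^ N < t) (hz : ∀ p ∈ heavy ν t N, prim g (midpt p) = 0) :
    ∫ x, prim g x * prim g x ∂ν ≤ t * ‖g‖ ^ 2 := by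
  have h := setIntegral_dyadic_prim_sq_le hg hN hz N 0 0 (zero_add N) (by simp)
    (by rw [prim_of_notMem]; simp)
  have hd : dyadic 0 0 = Ioc 0 1 := by simp [dyadic]
  rw [hd, ← integral_Icc_eq_integral_Ioc (μ := volume), setIntegral_sq_eq_norm_sq] at h
  rw [setIntegral_eq_integral_of_forall_compl_eq_zero] at h
  · simpa only [sq] using h
  · intro x hx
    rw [prim_of_notMem (fun h => hx (Ioo_subset_Ioc_self h))]
    simp

end Dyadic

/-! ### The operator of the form and the eigenvalue counting function -/

section Operator

variable (ν : Measure ℝ) [IsFiniteMeasure ν]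

/-- The bilinear form `∫ f g dν` in terms of derivatives, compressed to the form domain. -/
def massForm : GradSpace →L[ℝ] GradSpace →L[ℝ] ℝ :=
  LinearMap.mkContinuous₂ (LinearMap.mk₂ ℝ
    (fun g h => ∫ x, prim ((gradDom ν).starProjection g) x *
      prim ((gradDom ν).starProjection h) x ∂ν)
    (fun g g' h => by
      rw [← integral_add]
      · refine integral_congr_ae (Eventually.of_forall fun x => ?_)
        simp only [map_add, Pi.add_apply, add_mul]
      · exact integrable_prim_mul_prim (starProjection_gradDom_mem_meanZero g)
          (starProjection_gradDom_mem_meanZero h)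
      · exact integrable_prim_mul_prim (starProjection_gradDom_mem_meanZero g')
          (starProjection_gradDom_mem_meanZero h))
    (fun c g h => by
      rw [smul_eq_mul, ← integral_const_mul]
      refine integral_congr_ae (Eventually.of_forall fun x => ?_)
      simp only [map_smul, Pi.smul_apply, smul_eq_mul, mul_assoc])
    (fun g h h' => by
      rw [← integral_add]
      · refine integral_congr_ae (Eventually.of_forall fun x => ?_)
        simp only [map_add, Pi.add_apply, mul_add]
      · exact integrable_prim_mul_prim (starProjection_gradDom_mem_meanZero g)
          (starProjection_gradDom_mem_meanZero h)
      · exact integrable_prim_mul_prim (starProjection_gradDom_mem_meanZero g)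
          (starProjection_gradDom_mem_meanZero h'))
    (fun c g h => by
      rw [smul_eq_mul, ← integral_const_mul]
      refine integral_congr_ae (Eventually.of_forall fun x => ?_)
      simp only [map_smul, Pi.smul_apply, smul_eq_mul]
      ring))
    (ν.real univ) (fun g h => by
      rw [LinearMap.mk₂_apply, mul_assoc, mul_comm]
      refine norm_integral_le_of_norm_le_const (Eventually.of_forall fun x => ?_)
      rw [norm_mul]
      exact mul_le_mul
        ((abs_prim_le _ x).trans (Submodule.norm_starProjection_apply_le _ g))
        ((abs_prim_le _ x).trans (Submodule.norm_starProjection_apply_le _ h))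
        (norm_nonneg _) (norm_nonneg _))

/-- The operator `T` with `⟪T g, h⟫ = ∫ f_g f_h dν` on the form domain. -/
def massOp : GradSpace →L[ℝ] GradSpace :=
  InnerProductSpace.continuousLinearMapOfBilin (𝕜 := ℝ) (massForm ν)

variable {ν}

theorem inner_massOp (g h : GradSpace) :
    ⟪massOp ν g, h⟫_ℝ = ∫ x, prim ((gradDom ν).starProjection g) x *
      prim ((gradDom ν).starProjection h) x ∂ν :=
  InnerProductSpace.continuousLinearMapOfBilin_apply (𝕜 := ℝ) (massForm ν) g h

theorem inner_massOp_of_mem {g h : GradSpace} (hg : g ∈ gradDom ν) (hh : h ∈ gradDom ν) :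
    ⟪massOp ν g, h⟫_ℝ = ∫ x, prim g x * prim h x ∂ν := by
  rw [inner_massOp, Submodule.starProjection_eq_self_iff.2 hg,
    Submodule.starProjection_eq_self_iff.2 hh]

theorem massOp_isSymmetric : (massOp ν).IsSymmetric := by
  intro g h
  change ⟪massOp ν g, h⟫_ℝ = ⟪g, massOp ν h⟫_ℝ
  rw [real_inner_comm (massOp ν h) g, inner_massOp, inner_massOp]
  simp_rw [mul_comm]

theorem inner_massOp_self_nonneg (g : GradSpace) : 0 ≤ ⟪massOp ν g, g⟫_ℝ := by
  rw [inner_massOp]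
  exact integral_nonneg fun x => mul_self_nonneg _

theorem inner_massOp_starProjection (g h : GradSpace) :
    ⟪massOp ν g, (gradDom ν).starProjection h⟫_ℝ = ⟪massOp ν g, h⟫_ℝ := by
  rw [inner_massOp, inner_massOp, Submodule.starProjection_eq_self_iff.2
    (Submodule.starProjection_apply_mem (gradDom ν) h)]

theorem massOp_mem (g : GradSpace) : massOp ν g ∈ gradDom ν := by
  rw [← Submodule.starProjection_eq_self_iff]
  refine ext_inner_right ℝ fun h => ?_
  rw [Submodule.inner_starProjection_left_eq_right, inner_massOp_starProjection]

theorem exists_nat_measure_div_lt {ν : Measure ℝ} {t : ℝ} (ht : 0 < t) :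
    ∃ N : ℕ, ν.real univ / 2 ^ N < t := by
  have h : Tendsto (fun N : ℕ => ν.real univ / (2 : ℝ) ^ N) atTop (𝓝 0) :=
    tendsto_const_nhds.div_atTop (tendsto_pow_atTop_atTop_of_one_lt one_lt_two)
  exact (h.eventually_lt_const ht).exists

/-- The midpoints of the finitely many heavy intervals give finitely many vectors; for a function
orthogonal to all of them the dyadic estimate makes the mass form small. -/
theorem massOp_isCompactOperator : IsCompactOperator (massOp ν) := by
  classical
  refine isCompactOperator_of_forall_finiteDimensional massOp_isSymmetric
    inner_massOp_self_nonneg fun ε hε => ?_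
  obtain ⟨N, hN⟩ := exists_nat_measure_div_lt (ν := ν) hε
  refine ⟨Submodule.span ℝ ((heavy ν ε N).image
    fun p => (gradDom ν).starProjection (cutoff (midpt p))), inferInstance, fun u hu => ?_⟩
  rw [inner_massOp]
  refine (integral_prim_sq_le (starProjection_gradDom_mem_meanZero u) hN fun p hp => ?_).trans ?_
  · rw [prim_apply (midpt_mem (heavy_lt hp)), ← Submodule.inner_starProjection_left_eq_right]
    exact (Submodule.mem_orthogonal _ _).1 hu _ (Submodule.subset_span
      (Finset.mem_coe.2 (Finset.mem_image_of_mem _ hp)))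
  · gcongr
    exact Submodule.norm_starProjection_apply_le _ u

theorem mem_gradDom_of_mem_recipEigen {x : ℝ} {g : GradSpace} (hg : g ∈ recipEigen (massOp ν) x) :
    g ∈ gradDom ν := by
  obtain ⟨l, -, -, h⟩ := hg
  rw [← h]
  exact Submodule.smul_mem _ _ (massOp_mem g)

theorem span_recipEigen_le (x : ℝ) :
    Submodule.span ℝ (recipEigen (massOp ν) x) ≤ gradDom ν :=
  Submodule.span_le.2 fun _ hg => mem_gradDom_of_mem_recipEigen hg

/-- Testing the weak equation with `l • massOp ν g - g`, which lies in the domain, gives the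
operator equation. Testing with `g` itself forces `l > 0`, so restricting `recipEigen` to positive
`l` loses nothing. -/
theorem setOf_eigenfunction_eq (x : ℝ) :
    {f : ℝ → ℝ | ∃ l ≤ x, IsEigenfunction ν l f} =
      prim '' (recipEigen (massOp ν) x \ {0}) := by
  ext f
  constructor
  · rintro ⟨l, hlx, hf, hf0, hl⟩
    rw [dom_eq_image_prim] at hf
    obtain ⟨g, hg, rfl⟩ := hf
    have hg0 : g ≠ 0 := by
      rintro rfl
      exact hf0 (map_zero prim)
    have key : ∀ h ∈ gradDom ν, ⟪g, h⟫_ℝ = l * ⟪massOp ν g, h⟫_ℝ := by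
      intro h hh
      have := hl (prim h) (by rw [dom_eq_image_prim]; exact ⟨h, hh, rfl⟩)
      rwa [form_prim hg.1 hh.1, ← inner_massOp_of_mem hg hh] at this
    have hlpos : 0 < l := by
      have h1 := key g hg
      have h2 : 0 < ⟪g, g⟫_ℝ := real_inner_self_pos.2 hg0
      rw [h1] at h2
      exact pos_of_mul_pos_left h2 (inner_massOp_self_nonneg g)
    refine ⟨g, ⟨⟨l, hlpos, hlx, ?_⟩, hg0⟩, rfl⟩
    have hmem : l • massOp ν g - g ∈ gradDom ν :=
      Submodule.sub_mem _ (Submodule.smul_mem _ _ (massOp_mem g)) hg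
    have h3 := key _ hmem
    rw [← sub_eq_zero, ← inner_self_eq_zero (𝕜 := ℝ), inner_sub_left, real_inner_smul_left, h3,
      sub_self]
  · rintro ⟨g, ⟨hg, hg0⟩, rfl⟩
    have hgd := mem_gradDom_of_mem_recipEigen hg
    obtain ⟨l, -, hlx, h⟩ := hg
    refine ⟨l, hlx, ?_, fun hz => hg0 (eq_zero_of_prim_eq_zero hgd.1 hz), fun f hf => ?_⟩
    · rw [dom_eq_image_prim]
      exact ⟨g, hgd, rfl⟩
    · rw [dom_eq_image_prim] at hf
      obtain ⟨k, hk, rfl⟩ := hf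
      rw [form_prim hgd.1 hk.1, ← inner_massOp_of_mem hgd hk, ← real_inner_smul_left, h]

theorem eigenCount_eq (x : ℝ) : eigenCount ν x =
    Cardinal.toENat (Module.rank ℝ (Submodule.span ℝ (recipEigen (massOp ν) x))) := by
  set W := Submodule.span ℝ (recipEigen (massOp ν) x) with hW
  have hinj : Function.Injective (prim.domRestrict W) := by
    rw [← LinearMap.ker_eq_bot, LinearMap.ker_eq_bot']
    intro g hg
    exact Subtype.ext (eq_zero_of_prim_eq_zero (span_recipEigen_le x g.2).1 hg)
  have hspan : Submodule.span ℝ {f : ℝ → ℝ | ∃ l ≤ x, IsEigenfunction ν l f} =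
      LinearMap.range (prim.domRestrict W) := by
    rw [setOf_eigenfunction_eq, ← Submodule.map_span, Submodule.span_sdiff_singleton_zero,
      LinearMap.range_domRestrict]
  rw [eigenCount, hspan, ← (LinearEquiv.ofInjective _ hinj).rank_eq]

/-- Upper bound of the counting function by the number of heavy dyadic intervals. -/
theorem eigenCount_le {x : ℝ} (hx : 0 < x) {N : ℕ} (hN : ν.real univ / 2 ^ N < 1 / (2 * x)) :
    eigenCount ν x ≤ (heavy ν (1 / (2 * x)) N).card := by
  set W := Submodule.span ℝ (recipEigen (massOp ν) x) with hW
  -- Evaluation at the heavy midpoints is injective on `W`: on its kernel the threshold `1/(2x)`,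
  -- rather than `1/x`, yields `‖g‖² ≤ ‖g‖²/2`.
  let L : GradSpace →ₗ[ℝ] (heavy ν (1 / (2 * x)) N → ℝ) :=
    LinearMap.pi fun p => (LinearMap.proj (midpt p)) ∘ₗ prim
  have hinj : Function.Injective (L.domRestrict W) := by
    rw [← LinearMap.ker_eq_bot, LinearMap.ker_eq_bot']
    rintro ⟨g, hg⟩ hg0
    have hgd := span_recipEigen_le x hg
    have h1 := norm_sq_le_of_mem_span_recipEigen massOp_isSymmetric hg
    have h2 := integral_prim_sq_le hgd.1 hN fun p hp => congrFun hg0 ⟨p, hp⟩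
    rw [inner_massOp_of_mem hgd hgd] at h1
    have h3 : ‖g‖ ^ 2 ≤ x * (1 / (2 * x) * ‖g‖ ^ 2) :=
      h1.trans (mul_le_mul_of_nonneg_left h2 hx.le)
    have h4 : x * (1 / (2 * x) * ‖g‖ ^ 2) = ‖g‖ ^ 2 / 2 := by field_simp
    have h5 : ‖g‖ ^ 2 = 0 := le_antisymm (by linarith) (sq_nonneg _)
    exact Subtype.ext (norm_eq_zero.1 (pow_eq_zero_iff two_ne_zero |>.1 h5))
  have hr := LinearMap.rank_le_of_injective _ hinj
  rw [rank_fun', Fintype.card_coe] at hr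
  rw [eigenCount_eq, Cardinal.toENat_le_natCast]
  exact hr

/-- Lower bound of the counting function by functions with disjoint supports. -/
theorem card_le_eigenCount {ι : Type*} (s : Finset ι) (g : ι → GradSpace) {x : ℝ} (hx : 0 < x)
    (hg : ∀ i ∈ s, g i ∈ meanZero) (hne : ∀ i ∈ s, g i ≠ 0)
    (horth : ∀ i ∈ s, ∀ j ∈ s, i ≠ j → ⟪g i, g j⟫_ℝ = 0)
    (hdisj : ∀ i ∈ s, ∀ j ∈ s, i ≠ j → ∀ y, prim (g i) y * prim (g j) y = 0)
    (hle : ∀ i ∈ s, ‖g i‖ ^ 2 ≤ x * ∫ y, prim (g i) y * prim (g i) y ∂ν) :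
    (s.card : ℕ∞) ≤ eigenCount ν x := by
  classical
  let L₀ : (s → ℝ) →ₗ[ℝ] GradSpace := Fintype.linearCombination ℝ fun i : s => g i
  have hL₀ : ∀ c, L₀ c = ∑ i, c i • g i := fun c => Fintype.linearCombination_apply ℝ _ c
  -- The test functions need not be affine off the support. Projecting onto the form domain repairs
  -- this: the mass is unchanged and the energy does not increase.
  let L : (s → ℝ) →ₗ[ℝ] GradSpace := ((gradDom ν).starProjection : GradSpace →ₗ[ℝ] GradSpace) ∘ₗ L₀
  have hLm : ∀ c, L₀ c ∈ meanZero := fun c => by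
    rw [hL₀]
    exact Submodule.sum_mem _ fun i _ => Submodule.smul_mem _ _ (hg i i.2)
  have hnorm : ∀ c, ‖L₀ c‖ ^ 2 = ∑ i, c i ^ 2 * ‖g i‖ ^ 2 := by
    intro c
    rw [hL₀, ← real_inner_self_eq_norm_sq, sum_inner]
    refine Finset.sum_congr rfl fun i _ => ?_
    rw [inner_sum, Finset.sum_eq_single i]
    · rw [real_inner_smul_left, real_inner_smul_right, real_inner_self_eq_norm_sq]
      ring
    · intro j _ hj
      rw [real_inner_smul_left, real_inner_smul_right,
        horth i i.2 j j.2 fun h => hj (Subtype.ext h.symm)]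
      simp
    · simp
  have hmass : ∀ c, ∫ y, prim (L₀ c) y * prim (L₀ c) y ∂ν =
      ∑ i, c i ^ 2 * ∫ y, prim (g i) y * prim (g i) y ∂ν := by
    intro c
    have e : ∀ y, prim (L₀ c) y * prim (L₀ c) y =
        ∑ i : s, c i ^ 2 * (prim (g i) y * prim (g i) y) := by
      intro y
      rw [hL₀, map_sum, Finset.sum_apply, Finset.sum_mul_sum]
      refine Finset.sum_congr rfl fun i _ => ?_
      rw [Finset.sum_eq_single i]
      · simp only [map_smul, Pi.smul_apply, smul_eq_mul]
        ring
      · intro j _ hj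
        have := hdisj i i.2 j j.2 (fun h => hj (Subtype.ext h.symm)) y
        simp only [map_smul, Pi.smul_apply, smul_eq_mul]
        linear_combination c i * c j * this
      · simp
    simp_rw [e]
    rw [integral_finsetSum _ fun (i : s) _ =>
      (integrable_prim_mul_prim (hg i i.2) (hg i i.2)).const_mul _]
    simp_rw [integral_const_mul]
  have hle₀ : ∀ c, ‖L₀ c‖ ^ 2 ≤ x * ∫ y, prim (L₀ c) y * prim (L₀ c) y ∂ν := by
    intro c
    rw [hnorm, hmass, Finset.mul_sum]
    refine Finset.sum_le_sum fun i _ => ?_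
    rw [mul_left_comm]
    exact mul_le_mul_of_nonneg_left (hle i i.2) (sq_nonneg _)
  have hmassL : ∀ c, ⟪massOp ν (L c), L c⟫_ℝ = ∫ y, prim (L₀ c) y * prim (L₀ c) y ∂ν := by
    intro c
    have hm : L c ∈ gradDom ν := Submodule.starProjection_apply_mem _ _
    rw [inner_massOp_of_mem hm hm]
    refine integral_congr_ae ?_
    filter_upwards [Measure.support_mem_ae (μ := ν)] with y hy
    have := prim_starProjection_gradDom (ν := ν) (hLm c) hy
    change prim ((gradDom ν).starProjection (L₀ c)) y *
      prim ((gradDom ν).starProjection (L₀ c)) y = _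
    rw [this]
  have hcard := card_le_rank_span_recipEigen (massOp_isCompactOperator (ν := ν))
    massOp_isSymmetric inner_massOp_self_nonneg hx L ?_ ?_
  · rw [Fintype.card_coe] at hcard
    rw [eigenCount_eq, Cardinal.natCast_le_toENat]
    exact hcard
  -- If the projection kills a combination, its mass is zero, hence by `hle₀` so is its energy
  -- before projection.
  · intro c hc hLc
    have h1 := hle₀ c
    rw [← hmassL, hLc, inner_zero_right, mul_zero, hnorm] at h1
    apply hc
    funext i
    have h2 := (Finset.sum_eq_zero_iff_of_nonneg fun i _ => by positivity).1
      (le_antisymm h1 (Finset.sum_nonneg fun i _ => by positivity)) i (Finset.mem_univ i)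
    rcases mul_eq_zero.1 h2 with h | h
    · exact pow_eq_zero_iff two_ne_zero |>.1 h
    · exact (hne i i.2 (norm_eq_zero.1 (pow_eq_zero_iff two_ne_zero |>.1 h))).elim
  · intro c
    rw [hmassL]
    refine le_trans ?_ (hle₀ c)
    gcongr
    exact Submodule.norm_starProjection_apply_le _ _

end Operator

/-! ### Lower bounds of the counting function by trapezoidal functions -/

/-- The derivative of the trapezoidal function that is `1` on `[a,b]` and `0` outside
`[a-δ,b+δ]`. -/
def bump (δ a b : ℝ) : GradSpace :=
  δ⁻¹ • (cutoff a - cutoff (a - δ) - cutoff (b + δ) + cutoff b)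

section Bump

variable {δ a b x : ℝ}

theorem inner_cutoff_bump (hδ : 0 < δ) (ha : 0 ≤ a - δ) (hab : a ≤ b) (hb : b + δ ≤ 1)
    (hx : x ∈ Icc (0 : ℝ) 1) : ⟪cutoff x, bump δ a b⟫_ℝ =
      δ⁻¹ * (min x a - min x (a - δ) - min x (b + δ) + min x b) := by
  rw [bump, inner_smul_right, inner_add_right, inner_sub_right, inner_sub_right,
    inner_cutoff_cutoff hx ⟨by linarith, by linarith⟩,
    inner_cutoff_cutoff hx ⟨by linarith, by linarith⟩,
    inner_cutoff_cutoff hx ⟨by linarith, by linarith⟩,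
    inner_cutoff_cutoff hx ⟨by linarith, by linarith⟩]

theorem inner_bump_left (g : GradSpace) : ⟪bump δ a b, g⟫_ℝ =
    δ⁻¹ * (⟪cutoff a, g⟫_ℝ - ⟪cutoff (a - δ), g⟫_ℝ - ⟪cutoff (b + δ), g⟫_ℝ + ⟪cutoff b, g⟫_ℝ) := by
  rw [bump, real_inner_smul_left, inner_add_left, inner_sub_left, inner_sub_left]

theorem inner_cutoff_bump_of_le (hδ : 0 < δ) (ha : 0 ≤ a - δ) (hab : a ≤ b) (hb : b + δ ≤ 1)
    (hx : x ∈ Icc (0 : ℝ) 1) (h : x ≤ a - δ) : ⟪cutoff x, bump δ a b⟫_ℝ = 0 := by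
  rw [inner_cutoff_bump hδ ha hab hb hx, min_eq_left (by linarith), min_eq_left h,
    min_eq_left (by linarith), min_eq_left (by linarith)]
  ring

theorem inner_cutoff_bump_of_ge (hδ : 0 < δ) (ha : 0 ≤ a - δ) (hab : a ≤ b) (hb : b + δ ≤ 1)
    (hx : x ∈ Icc (0 : ℝ) 1) (h : b + δ ≤ x) : ⟪cutoff x, bump δ a b⟫_ℝ = 0 := by
  rw [inner_cutoff_bump hδ ha hab hb hx, min_eq_right (by linarith), min_eq_right (by linarith),
    min_eq_right h, min_eq_right (by linarith)]
  ring

theorem inner_cutoff_bump_of_mem (hδ : 0 < δ) (ha : 0 ≤ a - δ) (hab : a ≤ b) (hb : b + δ ≤ 1)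
    (h : x ∈ Icc a b) : ⟪cutoff x, bump δ a b⟫_ℝ = 1 := by
  have h1 := h.1
  have h2 := h.2
  rw [inner_cutoff_bump hδ ha hab hb ⟨by linarith, by linarith⟩, min_eq_right h1,
    min_eq_right (by linarith), min_eq_left (by linarith), min_eq_left h2]
  field_simp
  ring

theorem bump_mem_meanZero (hδ : 0 < δ) (ha : 0 ≤ a - δ) (hab : a ≤ b) (hb : b + δ ≤ 1) :
    bump δ a b ∈ meanZero :=
  mem_meanZero.2 (inner_cutoff_bump_of_ge hδ ha hab hb ⟨zero_le_one, le_rfl⟩ hb)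

theorem norm_bump_sq (hδ : 0 < δ) (ha : 0 ≤ a - δ) (hab : a ≤ b) (hb : b + δ ≤ 1) :
    ‖bump δ a b‖ ^ 2 = 2 / δ := by
  rw [← real_inner_self_eq_norm_sq, inner_bump_left,
    inner_cutoff_bump_of_mem hδ ha hab hb ⟨le_rfl, hab⟩,
    inner_cutoff_bump_of_mem hδ ha hab hb ⟨hab, le_rfl⟩,
    inner_cutoff_bump_of_le hδ ha hab hb ⟨ha, by linarith⟩ le_rfl,
    inner_cutoff_bump_of_ge hδ ha hab hb ⟨by linarith, hb⟩ le_rfl]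
  ring

theorem prim_bump_eq_zero (hδ : 0 < δ) (ha : 0 ≤ a - δ) (hab : a ≤ b) (hb : b + δ ≤ 1)
    (h : x ≤ a - δ ∨ b + δ ≤ x) : prim (bump δ a b) x = 0 := by
  by_cases hx : x ∈ Ioo (0 : ℝ) 1
  · rw [prim_apply hx]
    rcases h with h | h
    · exact inner_cutoff_bump_of_le hδ ha hab hb (Ioo_subset_Icc_self hx) h
    · exact inner_cutoff_bump_of_ge hδ ha hab hb (Ioo_subset_Icc_self hx) h
  · exact prim_of_notMem hx _

theorem le_integral_prim_bump_sq {ν : Measure ℝ} [IsFiniteMeasure ν] (hδ : 0 < δ)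
    (ha : 0 ≤ a - δ) (hab : a ≤ b) (hb : b + δ ≤ 1) :
    ν.real (Icc a b) ≤ ∫ y, prim (bump δ a b) y * prim (bump δ a b) y ∂ν := by
  have hm := bump_mem_meanZero hδ ha hab hb
  calc ν.real (Icc a b) = ∫ y in Icc a b, (1 : ℝ) ∂ν := by simp
    _ = ∫ y in Icc a b, prim (bump δ a b) y * prim (bump δ a b) y ∂ν := by
        refine setIntegral_congr_fun measurableSet_Icc fun y hy => ?_
        have hy1 := hy.1
        have hy2 := hy.2
        have : prim (bump δ a b) y = 1 := by
          rw [prim_apply ⟨by linarith, by linarith⟩, inner_cutoff_bump_of_mem hδ ha hab hb hy]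
        simp [this]
    _ ≤ _ := setIntegral_le_integral (integrable_prim_mul_prim hm hm)
        (Eventually.of_forall fun y => mul_self_nonneg _)

end Bump

/-! ### Eigenvalue counts from below, in terms of coarse counts -/

section Count

variable {ν : Measure ℝ}

theorem eigenCount_mono : Monotone (eigenCount ν) := by
  intro x y hxy
  refine Cardinal.toENat.monotone' (Submodule.rank_mono (Submodule.span_mono ?_))
  rintro f ⟨l, hl, hf⟩
  exact ⟨l, hl.trans hxy, hf⟩

variable [IsFiniteMeasure ν]

/-- Each trapezoid has energy `2/δ` and mass at least that of its plateau. The separation condition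
lets supports touch but not overlap, which is enough to make both forms diagonal. -/
theorem card_le_eigenCount_of_bump {ι : Type*} (s : Finset ι) (a b : ι → ℝ) {δ x : ℝ}
    (hδ : 0 < δ) (hx : 0 < x) (ha : ∀ i ∈ s, 0 ≤ a i - δ) (hab : ∀ i ∈ s, a i ≤ b i)
    (hb : ∀ i ∈ s, b i + δ ≤ 1)
    (hsep : ∀ i ∈ s, ∀ j ∈ s, i ≠ j → b i + δ ≤ a j - δ ∨ b j + δ ≤ a i - δ)
    (hν : ∀ i ∈ s, 2 / δ ≤ x * ν.real (Icc (a i) (b i))) :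
    (s.card : ℕ∞) ≤ eigenCount ν x := by
  refine card_le_eigenCount s (fun i => bump δ (a i) (b i)) hx
    (fun i hi => bump_mem_meanZero hδ (ha i hi) (hab i hi) (hb i hi)) (fun i hi h0 => ?_)
    (fun i hi j hj hij => ?_) (fun i hi j hj hij y => ?_) (fun i hi => ?_)
  · have h1 := norm_bump_sq hδ (ha i hi) (hab i hi) (hb i hi)
    rw [h0, norm_zero, zero_pow two_ne_zero] at h1
    have : 0 < 2 / δ := by positivity
    exact this.ne h1
  · have hi1 := ha i hi
    have hi2 := hab i hi
    have hi3 := hb i hi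
    have hj1 := ha j hj
    have hj2 := hab j hj
    have hj3 := hb j hj
    have key : ∀ z ∈ Icc (0 : ℝ) 1, z ∈ Icc (a i - δ) (b i + δ) →
        ⟪cutoff z, bump δ (a j) (b j)⟫_ℝ = 0 := by
      intro z hz hz'
      rcases hsep i hi j hj hij with h | h
      · exact inner_cutoff_bump_of_le hδ hj1 hj2 hj3 hz (hz'.2.trans h)
      · exact inner_cutoff_bump_of_ge hδ hj1 hj2 hj3 hz (h.trans hz'.1)
    rw [inner_bump_left, key _ ⟨by linarith, by linarith⟩ ⟨by linarith, by linarith⟩,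
      key _ ⟨by linarith, by linarith⟩ ⟨by linarith, by linarith⟩,
      key _ ⟨by linarith, by linarith⟩ ⟨by linarith, by linarith⟩,
      key _ ⟨by linarith, by linarith⟩ ⟨by linarith, by linarith⟩]
    ring
  · rcases le_total y (a i - δ) with h | h
    · rw [prim_bump_eq_zero hδ (ha i hi) (hab i hi) (hb i hi) (Or.inl h), zero_mul]
    rcases le_total (b i + δ) y with h' | h'
    · rw [prim_bump_eq_zero hδ (ha i hi) (hab i hi) (hb i hi) (Or.inr h'), zero_mul]
    · rw [prim_bump_eq_zero hδ (ha j hj) (hab j hj) (hb j hj), mul_zero]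
      rcases hsep i hi j hj hij with h2 | h2
      · exact Or.inl (h'.trans h2)
      · exact Or.inr (h2.trans h)
  · rw [norm_bump_sq hδ (ha i hi) (hab i hi) (hb i hi)]
    exact (hν i hi).trans (mul_le_mul_of_nonneg_left
      (le_integral_prim_bump_sq hδ (ha i hi) (hab i hi) (hb i hi)) hx.le)

/-- One eigenvalue keeps `spectralRatio` away from `⊥` for large `x`; this settles the case `qBar ν
= 0`. -/
theorem exists_one_le_eigenCount (hν : ν ≠ 0) (hsupp : ν (Ioo 0 1)ᶜ = 0) :
    ∃ x, 1 ≤ eigenCount ν x := by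
  obtain ⟨n, hn⟩ : ∃ n : ℕ, 0 < ν (Icc (1 / ((n : ℝ) + 2)) (1 - 1 / ((n : ℝ) + 2))) := by
    by_contra! h
    apply hν
    rw [← Measure.measure_univ_eq_zero, ← union_compl_self (Ioo (0 : ℝ) 1)]
    refine measure_union_null ?_ hsupp
    refine measure_mono_null (t := ⋃ n : ℕ, Icc (1 / ((n : ℝ) + 2)) (1 - 1 / ((n : ℝ) + 2))) ?_
      (measure_iUnion_null fun n => le_antisymm (h n) (zero_le))
    intro x hx
    obtain ⟨n, hn⟩ := exists_nat_one_div_lt (lt_min hx.1 (sub_pos.2 hx.2))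
    rw [lt_min_iff] at hn
    have h1 : 1 / ((n : ℝ) + 2) ≤ 1 / ((n : ℝ) + 1) := by gcongr; norm_num
    exact mem_iUnion.2 ⟨n, by linarith [hn.1], by linarith [hn.2]⟩
  set δ : ℝ := 1 / ((n : ℝ) + 2) with hδ
  have hδ0 : 0 < δ := by positivity
  have hδ2 : δ ≤ 1 / 2 := by rw [hδ]; gcongr; linarith [(n.cast_nonneg : (0 : ℝ) ≤ n)]
  set m := ν.real (Icc δ (1 - δ)) with hm
  have hm0 : 0 < m := ENNReal.toReal_pos hn.ne' (measure_ne_top _ _)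
  refine ⟨2 / δ / m, ?_⟩
  have := card_le_eigenCount_of_bump (ν := ν) (Finset.univ : Finset Unit) (fun _ => δ)
    (fun _ => 1 - δ) (x := 2 / δ / m) hδ0 (by positivity) (fun _ _ => by linarith)
    (fun _ _ => by linarith) (fun _ _ => by linarith) (fun i _ j _ h => (h rfl).elim)
    (fun _ _ => by rw [div_mul_cancel₀ _ hm0.ne'])
  simpa using this

/-- A trapezoid over a level `n` interval with `δ = 2⁻ⁿ` also covers the two neighbours, so the
intervals are sorted by residue modulo `3`. The summand `2` accounts for the first and last
intervals, whose trapezoids would leave `[0,1]`. The argument of `eigenCount` is chosen so that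
`2/δ` equals it times `2^{-αn}`. -/
theorem coarseCount_le (α : ℝ) (n : ℕ) :
    (coarseCount ν α n : ℕ∞) ≤ 3 * eigenCount ν (2 * (2 : ℝ) ^ ((1 + α) * n)) + 2 := by
  classical
  set x : ℝ := 2 * (2 : ℝ) ^ ((1 + α) * n) with hx
  have hx0 : 0 < x := by positivity
  have h2n : (0 : ℝ) < 2 ^ n := by positivity
  set S := (Finset.range (2 ^ n)).filter
    (fun k => (2 : ℝ) ^ (-α * n) ≤ ν.real (dyadic n k)) with hS
  let R : ℕ → Finset ℕ := fun r => S.filter fun k => 1 ≤ k ∧ k + 2 ≤ 2 ^ n ∧ k % 3 = r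
  have hR : ∀ r, ((R r).card : ℕ∞) ≤ eigenCount ν x := by
    intro r
    have hmem : ∀ k ∈ R r, (1 : ℝ) ≤ k ∧ (k : ℝ) + 2 ≤ 2 ^ n ∧ k % 3 = r ∧
        (2 : ℝ) ^ (-α * n) ≤ ν.real (dyadic n k) := by
      intro k hk
      obtain ⟨hkS, h1, h2, h3⟩ := Finset.mem_filter.1 hk
      exact ⟨by exact_mod_cast h1, by exact_mod_cast h2, h3, (Finset.mem_filter.1 hkS).2⟩
    refine card_le_eigenCount_of_bump (R r) (fun k => (k : ℝ) / 2 ^ n)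
      (fun k => ((k : ℝ) + 1) / 2 ^ n) (δ := 1 / 2 ^ n) (by positivity) hx0 ?_ ?_ ?_ ?_ ?_
    · intro k hk
      rw [← sub_div]
      exact div_nonneg (by linarith [(hmem k hk).1]) h2n.le
    · intro k hk
      gcongr
      linarith
    · intro k hk
      rw [← add_div, div_le_one h2n]
      linarith [(hmem k hk).2.1]
    · intro k hk l hl hkl
      have hk3 := (hmem k hk).2.2.1
      have hl3 := (hmem l hl).2.2.1
      rw [← add_div, ← sub_div, ← add_div, ← sub_div, div_le_div_iff_of_pos_right h2n,
        div_le_div_iff_of_pos_right h2n]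
      rcases lt_or_gt_of_ne hkl with h | h
      · left
        have : k + 3 ≤ l := by omega
        have : (k : ℝ) + 3 ≤ l := by exact_mod_cast this
        linarith
      · right
        have : l + 3 ≤ k := by omega
        have : (l : ℝ) + 3 ≤ k := by exact_mod_cast this
        linarith
    · intro k hk
      have h1 : (2 : ℝ) ^ (-α * n) ≤ ν.real (Icc ((k : ℝ) / 2 ^ n) (((k : ℝ) + 1) / 2 ^ n)) :=
        (hmem k hk).2.2.2.trans (measureReal_mono Ioc_subset_Icc_self)
      refine le_trans (le_of_eq ?_) (mul_le_mul_of_nonneg_left h1 hx0.le)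
      rw [hx, mul_assoc, ← Real.rpow_add two_pos]
      have : (1 + α) * (n : ℝ) + -α * n = n := by ring
      rw [this, Real.rpow_natCast]
      field_simp
  have hcover : S ⊆ {0, 2 ^ n - 1} ∪ (R 0 ∪ R 1 ∪ R 2) := by
    intro k hk
    have hk2 : k < 2 ^ n := Finset.mem_range.1 (Finset.mem_filter.1 hk).1
    simp only [Finset.mem_union, Finset.mem_insert, Finset.mem_singleton, R, Finset.mem_filter]
    have : k % 3 < 3 := Nat.mod_lt _ (by norm_num)
    by_cases h0 : k = 0
    · exact Or.inl (Or.inl h0)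
    by_cases h1 : k = 2 ^ n - 1
    · exact Or.inl (Or.inr h1)
    right
    have h3 : 1 ≤ k := by omega
    have h4 : k + 2 ≤ 2 ^ n := by omega
    have h5 : k % 3 = 0 ∨ k % 3 = 1 ∨ k % 3 = 2 := by omega
    rcases h5 with h5 | h5 | h5
    · exact Or.inl (Or.inl ⟨hk, h3, h4, h5⟩)
    · exact Or.inl (Or.inr ⟨hk, h3, h4, h5⟩)
    · exact Or.inr ⟨hk, h3, h4, h5⟩
  have hcard : S.card ≤ (R 0).card + (R 1).card + (R 2).card + 2 := by
    refine (Finset.card_le_card hcover).trans ?_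
    refine (Finset.card_union_le _ _).trans ?_
    have h1 : ({0, 2 ^ n - 1} : Finset ℕ).card ≤ 2 := Finset.card_le_two
    have h2 := Finset.card_union_le (R 0 ∪ R 1) (R 2)
    have h3 := Finset.card_union_le (R 0) (R 1)
    omega
  have hcc : coarseCount ν α n = S.card := by
    rw [coarseCount, hS]
  calc (coarseCount ν α n : ℕ∞) ≤ (((R 0).card + (R 1).card + (R 2).card + 2 : ℕ) : ℕ∞) := by
        rw [hcc]
        exact_mod_cast hcard
    _ = (R 0).card + (R 1).card + (R 2).card + 2 := by push_cast; rfl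
    _ ≤ eigenCount ν x + eigenCount ν x + eigenCount ν x + 2 := by
        gcongr <;> exact hR _
    _ = _ := by ring

end Count

/-! ### The partition function -/

section Partition

open Classical in
/-- The indices of the dyadic intervals of level `n` with positive measure. -/
def charged (ν : Measure ℝ) (n : ℕ) : Finset ℕ :=
  (Finset.range (2 ^ n)).filter fun k => 0 < ν (dyadic n k)

/-- The partition function `∑ ν(C)^q`. -/
def partSum (ν : Measure ℝ) (n : ℕ) (q : ℝ) : ℝ := ∑ k ∈ charged ν n, ν.real (dyadic n k) ^ q

theorem betaN_eq (ν : Measure ℝ) (n : ℕ) (q : ℝ) :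
    betaN ν n q = Real.log (partSum ν n q) / (n * Real.log 2) := by
  rw [betaN, partSum, charged, Real.log_pow]

variable {ν : Measure ℝ} [IsFiniteMeasure ν]

theorem measureReal_pos_of_mem_charged {n k : ℕ} (hk : k ∈ charged ν n) :
    0 < ν.real (dyadic n k) :=
  ENNReal.toReal_pos (Finset.mem_filter.1 hk).2.ne' (measure_ne_top _ _)

theorem mem_charged_of_pos {ν : Measure ℝ} {n k : ℕ} (hk : k < 2 ^ n)
    (h : 0 < ν.real (dyadic n k)) :
    k ∈ charged ν n :=
  Finset.mem_filter.2 ⟨Finset.mem_range.2 hk, (ENNReal.toReal_pos_iff.1 h).1⟩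

theorem Ioo_subset_iUnion_dyadic (n : ℕ) :
    Ioo (0 : ℝ) 1 ⊆ ⋃ k ∈ Finset.range (2 ^ n), dyadic n k := by
  have h2n : (0 : ℝ) < 2 ^ n := by positivity
  intro x hx
  have hc : 0 < ⌈x * 2 ^ n⌉₊ := Nat.ceil_pos.2 (mul_pos hx.1 h2n)
  obtain ⟨k, hk⟩ : ∃ k, ⌈x * 2 ^ n⌉₊ = k + 1 := ⟨_, (Nat.succ_pred_eq_of_pos hc).symm⟩
  have hle := Nat.le_ceil (x * 2 ^ n)
  have hlt : ((k : ℕ) : ℝ) < x * 2 ^ n := Nat.lt_ceil.1 (by omega)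
  rw [hk] at hle
  push_cast at hle
  have hk2 : k < 2 ^ n := by
    have : (k : ℝ) < 2 ^ n := hlt.trans (by nlinarith [hx.2])
    exact_mod_cast this
  simp only [mem_iUnion, Finset.mem_range]
  exact ⟨k, hk2, (div_lt_iff₀ h2n).2 hlt, (le_div_iff₀ h2n).2 hle⟩

theorem charged_nonempty {ν : Measure ℝ} (hν : ν ≠ 0) (hsupp : ν (Ioo 0 1)ᶜ = 0) (n : ℕ) :
    (charged ν n).Nonempty := by
  by_contra hne
  rw [Finset.not_nonempty_iff_eq_empty, charged, Finset.filter_eq_empty_iff] at hne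
  have h0 : ν (Ioo 0 1) = 0 := by
    refine measure_mono_null (Ioo_subset_iUnion_dyadic n) ?_
    exact measure_iUnion_null fun k => measure_iUnion_null fun hk => by simpa using hne hk
  apply hν
  rw [← Measure.measure_univ_eq_zero, ← union_compl_self (Ioo (0 : ℝ) 1)]
  exact measure_union_null h0 hsupp

theorem partSum_pos (hν : ν ≠ 0) (hsupp : ν (Ioo 0 1)ᶜ = 0) (n : ℕ) (q : ℝ) :
    0 < partSum ν n q :=
  Finset.sum_pos (fun _ hk => Real.rpow_pos_of_pos (measureReal_pos_of_mem_charged hk) q)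
    (charged_nonempty hν hsupp n)

theorem partSum_eq_rpow (hν : ν ≠ 0) (hsupp : ν (Ioo 0 1)ᶜ = 0) {n : ℕ} (hn : 0 < n) (q : ℝ) :
    partSum ν n q = (2 : ℝ) ^ (n * betaN ν n q) := by
  have hn' : (n : ℝ) ≠ 0 := by positivity
  have hl : Real.log 2 ≠ 0 := (Real.log_pos one_lt_two).ne'
  have e : (n : ℝ) * betaN ν n q = Real.log (partSum ν n q) / Real.log 2 := by
    rw [betaN_eq]
    field_simp
  rw [e, Real.rpow_def_of_pos two_pos, mul_div_cancel₀ _ hl,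
    Real.exp_log (partSum_pos hν hsupp n q)]

/-- The error term in the monotonicity of `β_n`; it vanishes if `ν` has mass at most one. -/
def massErr (ν : Measure ℝ) (n : ℕ) : ℝ := Real.log (max 1 (ν.real univ)) / (n * Real.log 2)

theorem tendsto_massErr {ν : Measure ℝ} : Tendsto (massErr ν) atTop (𝓝 0) :=
  tendsto_const_nhds.div_atTop
    (tendsto_natCast_atTop_atTop.atTop_mul_const (Real.log_pos one_lt_two))

/-- Raising the exponent from `q` to `r` multiplies each term by `ν(C)^(r-q)`. This can exceed one
only if the total mass does, and costs a term of order `1/n`. -/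
theorem betaN_le_add (hν : ν ≠ 0) (hsupp : ν (Ioo 0 1)ᶜ = 0) {n : ℕ} (hn : 0 < n) {q r : ℝ}
    (hqr : q ≤ r) : betaN ν n r ≤ betaN ν n q + (r - q) * massErr ν n := by
  have hM : 0 < max 1 (ν.real univ) := lt_max_of_lt_left one_pos
  have hd : 0 < (n : ℝ) * Real.log 2 := mul_pos (by positivity) (Real.log_pos one_lt_two)
  have hle : partSum ν n r ≤ max 1 (ν.real univ) ^ (r - q) * partSum ν n q := by
    rw [partSum, partSum, Finset.mul_sum]
    refine Finset.sum_le_sum fun k hk => ?_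
    have hp := measureReal_pos_of_mem_charged hk
    have e : ν.real (dyadic n k) ^ r = ν.real (dyadic n k) ^ (r - q) * ν.real (dyadic n k) ^ q := by
      rw [← Real.rpow_add hp, sub_add_cancel]
    rw [e]
    refine mul_le_mul_of_nonneg_right ?_ (Real.rpow_nonneg hp.le _)
    refine Real.rpow_le_rpow hp.le ?_ (sub_nonneg.2 hqr)
    exact (measureReal_mono (subset_univ _)).trans (le_max_right _ _)
  rw [betaN_eq, betaN_eq, massErr, ← mul_div_assoc, ← add_div]
  refine div_le_div_of_nonneg_right ?_ hd.le
  refine (Real.log_le_log (partSum_pos hν hsupp n r) hle).trans (le_of_eq ?_)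
  rw [Real.log_mul (Real.rpow_pos_of_pos hM _).ne' (partSum_pos hν hsupp n q).ne',
    Real.log_rpow hM, add_comm]

theorem partSum_zero {ν : Measure ℝ} (n : ℕ) : partSum ν n 0 = (charged ν n).card := by
  simp [partSum]

theorem betaN_zero_le {ν : Measure ℝ} {n : ℕ} (hν : ν ≠ 0) (hsupp : ν (Ioo 0 1)ᶜ = 0) (hn : 0 < n) :
    betaN ν n 0 ≤ 1 := by
  have hd : 0 < (n : ℝ) * Real.log 2 := mul_pos (by positivity) (Real.log_pos one_lt_two)
  rw [betaN_eq, partSum_zero, div_le_one hd, ← Real.log_pow]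
  refine Real.log_le_log ?_ ?_
  · exact_mod_cast (charged_nonempty hν hsupp n).card_pos
  · have : (charged ν n).card ≤ 2 ^ n := by
      refine (Finset.card_filter_le _ _).trans ?_
      rw [Finset.card_range]
    exact_mod_cast this

theorem betaN_zero_nonneg {ν : Measure ℝ} (n : ℕ) : 0 ≤ betaN ν n 0 := by
  rw [betaN_eq, partSum_zero]
  exact div_nonneg (Real.log_natCast_nonneg _)
    (mul_nonneg (by positivity) (Real.log_pos one_lt_two).le)

/-- Comparison of `β_n(q)` with `q` in terms of the fixed point. -/
theorem eventually_fixedPt (hν : ν ≠ 0) (hsupp : ν (Ioo 0 1)ᶜ = 0) :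
    ∀ᶠ n : ℕ in atTop, (∀ q, fixedPt ν n ≤ q → betaN ν n q ≤ q) ∧
      (∀ q, q ≤ fixedPt ν n → q ≤ betaN ν n q) ∧ 0 ≤ fixedPt ν n ∧ fixedPt ν n ≤ 2 := by
  -- An error of at most `1/2` makes `β_n(q) - q` nonincreasing and gives `β_n(2) ≤ 1 + 2 · (1/2) =
  -- 2`, whence the bound `2` on the fixed point.
  filter_upwards [eventually_existsUnique_fixedPoint ν hν hsupp, eventually_gt_atTop 0,
    (tendsto_massErr (ν := ν)).eventually_le_const (by norm_num : (0 : ℝ) < 1 / 2)]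
    with n ⟨p, hp, hpu⟩ hn herr
  have hfix : fixedPt ν n = p := by
    have : Function.fixedPoints (betaN ν n) = {p} := by
      ext r
      exact ⟨fun h => hpu r h, fun h => by rw [mem_singleton_iff.1 h]; exact hp⟩
    rw [fixedPt, this, csInf_singleton]
  have hanti : ∀ q r, q ≤ r → betaN ν n r - r ≤ betaN ν n q - q := by
    intro q r hqr
    have h1 := betaN_le_add hν hsupp hn hqr
    have h2 : (r - q) * massErr ν n ≤ (r - q) * (1 / 2) :=
      mul_le_mul_of_nonneg_left herr (sub_nonneg.2 hqr)
    linarith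
  have hp' : betaN ν n p = p := hp
  rw [hfix]
  refine ⟨fun q hq => ?_, fun q hq => ?_, ?_, ?_⟩
  · have := hanti p q hq
    linarith
  · have := hanti q p hq
    linarith
  · by_contra! h
    have h1 := hanti p 0 h.le
    have h2 := betaN_zero_nonneg (ν := ν) n
    have h3 : betaN ν n 0 = 0 := by linarith
    exact h.ne (hpu 0 h3).symm
  · by_contra! h
    have h1 := hanti 2 p h.le
    have h2 := betaN_le_add hν hsupp hn (zero_le_two : (0 : ℝ) ≤ 2)
    have h3 := betaN_zero_le hν hsupp hn
    have h4 : betaN ν n 2 = 2 := by linarith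
    exact h.ne (hpu 2 h4)

theorem isBounded_fixedPt (hν : ν ≠ 0) (hsupp : ν (Ioo 0 1)ᶜ = 0) :
    IsBoundedUnder (· ≤ ·) atTop (fixedPt ν) ∧ IsBoundedUnder (· ≥ ·) atTop (fixedPt ν) :=
  ⟨⟨2, eventually_map.2 ((eventually_fixedPt hν hsupp).mono fun _ h => h.2.2.2)⟩,
    ⟨0, eventually_map.2 ((eventually_fixedPt hν hsupp).mono fun _ h => h.2.2.1)⟩⟩

theorem qBar_nonneg (hν : ν ≠ 0) (hsupp : ν (Ioo 0 1)ᶜ = 0) : 0 ≤ qBar ν :=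
  le_limsup_of_frequently_le
    ((eventually_fixedPt hν hsupp).mono fun _ h => h.2.2.1).frequently
    (isBounded_fixedPt hν hsupp).1

theorem eventually_betaN_le (hν : ν ≠ 0) (hsupp : ν (Ioo 0 1)ᶜ = 0) {q : ℝ} (hq : qBar ν < q) :
    ∀ᶠ n : ℕ in atTop, betaN ν n q ≤ q := by
  have h := eventually_lt_of_limsup_lt hq (isBounded_fixedPt hν hsupp).1
  filter_upwards [h, eventually_fixedPt hν hsupp] with n h1 h2
  exact h2.1 q h1.le

theorem le_beta_of_lt_qBar (hν : ν ≠ 0) (hsupp : ν (Ioo 0 1)ᶜ = 0) {q : ℝ} (hq : q < qBar ν) :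
    (q : EReal) ≤ beta ν q := by
  have h := frequently_lt_of_lt_limsup (isBounded_fixedPt hν hsupp).2.isCoboundedUnder_le hq
  refine le_limsup_of_frequently_le ?_
  refine (h.and_eventually (eventually_fixedPt hν hsupp)).mono fun n hn => ?_
  exact EReal.coe_le_coe_iff.2 (hn.2.2.1 q hn.1.le)

theorem beta_anti (hν : ν ≠ 0) (hsupp : ν (Ioo 0 1)ᶜ = 0) : Antitone (beta ν) := by
  intro q r hqr
  have h0 : Tendsto (fun n => (((r - q) * massErr ν n : ℝ) : EReal)) atTop
      (𝓝 ((0 : ℝ) : EReal)) := by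
    rw [EReal.tendsto_coe]
    simpa using (tendsto_massErr (ν := ν)).const_mul (r - q)
  have h1 : beta ν r ≤ limsup ((fun n => (betaN ν n q : EReal)) +
      fun n => (((r - q) * massErr ν n : ℝ) : EReal)) atTop := by
    refine limsup_le_limsup ?_
    filter_upwards [eventually_gt_atTop 0] with n hn
    rw [Pi.add_apply, ← EReal.coe_add]
    exact EReal.coe_le_coe_iff.2 (betaN_le_add hν hsupp hn hqr)
  have e := h0.limsup_eq
  refine h1.trans ((EReal.limsup_add_le ?_ ?_).trans ?_)
  · right
    rw [e]
    exact EReal.coe_ne_top _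
  · right
    rw [e]
    exact EReal.coe_ne_bot _
  · rw [e, EReal.coe_zero, add_zero]
    exact le_rfl

theorem beta_le_one (hν : ν ≠ 0) (hsupp : ν (Ioo 0 1)ᶜ = 0) {q : ℝ} (hq : 0 ≤ q) :
    beta ν q ≤ 1 := by
  refine (beta_anti hν hsupp hq).trans ?_
  refine limsup_le_of_le (by isBoundedDefault) ?_
  filter_upwards [eventually_gt_atTop 0] with n hn
  exact_mod_cast betaN_zero_le hν hsupp hn

end Partition

/-! ### Coarse multifractal dimensions -/

section Coarse

variable {ν : Measure ℝ}

theorem log_two_pow_pos {n : ℕ} (hn : 0 < n) : 0 < Real.log ((2 : ℝ) ^ n) :=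
  Real.log_pos (one_lt_pow₀ one_lt_two hn.ne')

theorem coarseRatio_nonneg (α : ℝ) (n : ℕ) : 0 ≤ coarseRatio ν α n :=
  div_nonneg Real.posLog_nonneg (Real.log_nonneg (one_le_pow₀ one_le_two))

theorem coarseRatio_le_of_le {α c : ℝ} {n : ℕ} (hn : 0 < n) (hc : 0 ≤ c)
    (h : (coarseCount ν α n : ℝ) ≤ (2 : ℝ) ^ (n * c)) : coarseRatio ν α n ≤ c := by
  rw [coarseRatio, div_le_iff₀ (log_two_pow_pos hn), Real.posLog, max_le_iff]
  refine ⟨mul_nonneg hc (log_two_pow_pos hn).le, ?_⟩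
  rcases (coarseCount ν α n).eq_zero_or_pos with h0 | h0
  · rw [h0, Nat.cast_zero, Real.log_zero]
    exact mul_nonneg hc (log_two_pow_pos hn).le
  · refine (Real.log_le_log (by exact_mod_cast h0) h).trans (le_of_eq ?_)
    rw [Real.log_rpow two_pos, Real.log_pow]
    ring

theorem le_coarseRatio_of_le {α c : ℝ} {n : ℕ} (hn : 0 < n)
    (h : (2 : ℝ) ^ (n * c) ≤ (coarseCount ν α n : ℝ)) : c ≤ coarseRatio ν α n := by
  rw [coarseRatio, le_div_iff₀ (log_two_pow_pos hn), Real.posLog]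
  refine le_max_of_le_right ?_
  refine le_trans (le_of_eq ?_) (Real.log_le_log (by positivity) h)
  rw [Real.log_rpow two_pos, Real.log_pow]
  ring

theorem coarseRatio_le_one (α : ℝ) (n : ℕ) : coarseRatio ν α n ≤ 1 := by
  rcases n.eq_zero_or_pos with rfl | hn
  · simp [coarseRatio]
  · refine coarseRatio_le_of_le hn zero_le_one ?_
    rw [mul_one, Real.rpow_natCast]
    have : coarseCount ν α n ≤ 2 ^ n := by
      refine (Finset.card_filter_le _ _).trans ?_
      rw [Finset.card_range]
    exact_mod_cast this

theorem isBoundedUnder_le_coarseRatio (α : ℝ) :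
    IsBoundedUnder (· ≤ ·) atTop (coarseRatio ν α) :=
  isBoundedUnder_of ⟨1, coarseRatio_le_one α⟩

theorem isBoundedUnder_ge_coarseRatio (α : ℝ) :
    IsBoundedUnder (· ≥ ·) atTop (coarseRatio ν α) :=
  isBoundedUnder_of ⟨0, coarseRatio_nonneg α⟩

theorem liminf_coarseRatio_le_limsup (α : ℝ) :
    liminf (coarseRatio ν α) atTop ≤ limsup (coarseRatio ν α) atTop :=
  liminf_le_limsup (isBoundedUnder_le_coarseRatio α) (isBoundedUnder_ge_coarseRatio α)

theorem limsup_coarseRatio_le_one (α : ℝ) : limsup (coarseRatio ν α) atTop ≤ 1 :=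
  limsup_le_of_le (isBoundedUnder_ge_coarseRatio α).isCoboundedUnder_le
    (Eventually.of_forall (coarseRatio_le_one α))

theorem liminf_coarseRatio_nonneg (α : ℝ) : 0 ≤ liminf (coarseRatio ν α) atTop :=
  le_liminf_of_le (isBoundedUnder_le_coarseRatio α).isCoboundedUnder_ge
    (Eventually.of_forall (coarseRatio_nonneg α))

theorem bddAbove_limsup_coarseRatio_div :
    BddAbove (range fun α : Ioi (0 : ℝ) => limsup (coarseRatio ν α) atTop / (1 + (α : ℝ))) := by
  refine ⟨1, ?_⟩
  rintro _ ⟨α, rfl⟩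
  have hα : (0 : ℝ) < α := α.2
  exact (div_le_one (by positivity)).2
    ((limsup_coarseRatio_le_one (α : ℝ)).trans (by linarith))

theorem bddAbove_liminf_coarseRatio_div :
    BddAbove (range fun α : Ioi (0 : ℝ) => liminf (coarseRatio ν α) atTop / (1 + (α : ℝ))) := by
  refine ⟨1, ?_⟩
  rintro _ ⟨α, rfl⟩
  have hα : (0 : ℝ) < α := α.2
  exact (div_le_one (by positivity)).2
    ((liminf_coarseRatio_le_limsup (α : ℝ)).trans
      ((limsup_coarseRatio_le_one (α : ℝ)).trans (by linarith)))

theorem le_lowerF {α : ℝ} (hα : 0 < α) :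
    liminf (coarseRatio ν α) atTop / (1 + α) ≤ lowerF ν :=
  le_ciSup bddAbove_liminf_coarseRatio_div (⟨α, hα⟩ : Ioi (0 : ℝ))

theorem lowerF_nonneg : 0 ≤ lowerF ν :=
  le_trans (div_nonneg (liminf_coarseRatio_nonneg 1) (by norm_num)) (le_lowerF one_pos)

theorem lowerF_le_upperF : lowerF ν ≤ upperF ν := by
  refine ciSup_mono bddAbove_limsup_coarseRatio_div fun α => ?_
  have hα : (0 : ℝ) < α := α.2
  exact div_le_div_of_nonneg_right (liminf_coarseRatio_le_limsup (α : ℝ)) (by positivity)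

variable [IsFiniteMeasure ν]

/-- Chebyshev: every counted interval contributes at least `2^{-αnq}` to the partition sum. -/
theorem coarseCount_le_rpow (hν : ν ≠ 0) (hsupp : ν (Ioo 0 1)ᶜ = 0) {q : ℝ} (hq : 0 ≤ q) (α : ℝ)
    {n : ℕ} (hn : 0 < n) :
    (coarseCount ν α n : ℝ) ≤ (2 : ℝ) ^ (n * (betaN ν n q + α * q)) := by
  classical
  set S := (Finset.range (2 ^ n)).filter
    (fun k => (2 : ℝ) ^ (-α * n) ≤ ν.real (dyadic n k)) with hS
  have hcc : coarseCount ν α n = S.card := by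
    rw [coarseCount, hS]
  have hsub : S ⊆ charged ν n := by
    intro k hk
    obtain ⟨h1, h2⟩ := Finset.mem_filter.1 hk
    exact mem_charged_of_pos (Finset.mem_range.1 h1) (lt_of_lt_of_le (by positivity) h2)
  have h1 : (S.card : ℝ) * ((2 : ℝ) ^ (-α * n)) ^ q ≤ partSum ν n q := by
    calc (S.card : ℝ) * ((2 : ℝ) ^ (-α * n)) ^ q = ∑ k ∈ S, ((2 : ℝ) ^ (-α * n)) ^ q := by
          rw [Finset.sum_const, nsmul_eq_mul]
      _ ≤ ∑ k ∈ S, ν.real (dyadic n k) ^ q := Finset.sum_le_sum fun k hk =>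
          Real.rpow_le_rpow (by positivity) (Finset.mem_filter.1 hk).2 hq
      _ ≤ partSum ν n q := Finset.sum_le_sum_of_subset_of_nonneg hsub fun k _ _ =>
          Real.rpow_nonneg measureReal_nonneg q
  rw [partSum_eq_rpow hν hsupp hn, ← Real.rpow_mul zero_le_two] at h1
  rw [hcc, mul_add, Real.rpow_add two_pos]
  have e : (2 : ℝ) ^ (n * (α * q)) * (2 : ℝ) ^ (-α * n * q) = 1 := by
    rw [← Real.rpow_add two_pos]
    have : (n : ℝ) * (α * q) + -α * n * q = 0 := by ring
    rw [this, Real.rpow_zero]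
  calc (S.card : ℝ) = (S.card * (2 : ℝ) ^ (-α * n * q)) * (2 : ℝ) ^ (n * (α * q)) := by
        rw [mul_assoc, mul_comm ((2 : ℝ) ^ (-α * n * q)), e, mul_one]
    _ ≤ _ := mul_le_mul_of_nonneg_right h1 (by positivity)

/-- For `q > qBar ν` eventually `β_n(q) ≤ q`, so Chebyshev bounds the exponent of the count by `q(1
+ α)`, for every `α` at once. -/
theorem upperF_le_qBar (hν : ν ≠ 0) (hsupp : ν (Ioo 0 1)ᶜ = 0) : upperF ν ≤ qBar ν := by
  refine le_of_forall_gt_imp_ge_of_dense fun q hq => ?_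
  have hq0 : 0 ≤ q := (qBar_nonneg hν hsupp).trans hq.le
  refine ciSup_le fun α => ?_
  have hα : (0 : ℝ) < α := α.2
  rw [div_le_iff₀ (by positivity)]
  refine limsup_le_of_le (isBoundedUnder_ge_coarseRatio _).isCoboundedUnder_le ?_
  filter_upwards [eventually_betaN_le hν hsupp hq, eventually_gt_atTop 0] with n h1 hn
  refine coarseRatio_le_of_le hn (by positivity)
    ((coarseCount_le_rpow hν hsupp hq0 α hn).trans ?_)
  refine Real.rpow_le_rpow_of_exponent_le one_le_two ?_
  refine mul_le_mul_of_nonneg_left ?_ (by positivity)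
  linarith

/-- Intervals of small, resp. large, mass contribute little to the partition function. -/
theorem partSum_le_of_exponents {n : ℕ} (hn : 0 < n) (hν : ν ≠ 0) (hsupp : ν (Ioo 0 1)ᶜ = 0)
    {q h α γ : ℝ} (hq : 0 ≤ q) (hh : 0 < h) :
    partSum ν n q ≤ (2 : ℝ) ^ (n * (betaN ν n (q - h) - α * h)) +
      (2 : ℝ) ^ (n * (betaN ν n (q + h) + γ * h)) +
      coarseCount ν α n * (2 : ℝ) ^ (n * (-γ * q)) := by
  classical
  -- Masses below `2^{-αn}` are compared with the exponent `q - h`, masses above `2^{-γn}` with `q +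
  -- h`. What remains is counted by `coarseCount`, each term being at most `2^{-γnq}`.
  have key : ∀ k ∈ charged ν n, ν.real (dyadic n k) ^ q ≤
      (2 : ℝ) ^ (-(α * n * h)) * ν.real (dyadic n k) ^ (q - h) +
      (2 : ℝ) ^ (γ * n * h) * ν.real (dyadic n k) ^ (q + h) +
      if (2 : ℝ) ^ (-α * n) ≤ ν.real (dyadic n k) then (2 : ℝ) ^ (n * (-γ * q)) else 0 := by
    intro k hk
    have hp := measureReal_pos_of_mem_charged hk
    set p := ν.real (dyadic n k)
    have n1 : 0 ≤ (2 : ℝ) ^ (-(α * n * h)) * p ^ (q - h) := by positivity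
    have n2 : 0 ≤ (2 : ℝ) ^ (γ * n * h) * p ^ (q + h) := by positivity
    split_ifs with hα
    · rcases le_total p ((2 : ℝ) ^ (-γ * n)) with hγ | hγ
      · have : p ^ q ≤ (2 : ℝ) ^ (n * (-γ * q)) := by
          refine (Real.rpow_le_rpow hp.le hγ hq).trans (le_of_eq ?_)
          rw [← Real.rpow_mul zero_le_two]
          congr 1
          ring
        linarith
      · have : p ^ q ≤ (2 : ℝ) ^ (γ * n * h) * p ^ (q + h) := by
          rw [Real.rpow_add hp, mul_left_comm]
          refine le_mul_of_one_le_right (by positivity) ?_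
          calc (1 : ℝ) = (2 : ℝ) ^ (γ * n * h) * ((2 : ℝ) ^ (-γ * n)) ^ h := by
                rw [← Real.rpow_mul zero_le_two, ← Real.rpow_add two_pos]
                have : γ * n * h + -γ * n * h = 0 := by ring
                rw [this, Real.rpow_zero]
            _ ≤ _ := by gcongr
        have n3 : (0 : ℝ) ≤ (2 : ℝ) ^ (n * (-γ * q)) := by positivity
        linarith
    · have : p ^ q ≤ (2 : ℝ) ^ (-(α * n * h)) * p ^ (q - h) := by
        have e : p ^ q = p ^ h * p ^ (q - h) := by
          rw [← Real.rpow_add hp, add_sub_cancel]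
        rw [e]
        refine mul_le_mul_of_nonneg_right ?_ (by positivity)
        refine (Real.rpow_le_rpow hp.le (not_le.1 hα).le hh.le).trans (le_of_eq ?_)
        rw [← Real.rpow_mul zero_le_two]
        congr 1
        ring
      linarith
  calc partSum ν n q ≤ _ := Finset.sum_le_sum key
    _ = (2 : ℝ) ^ (-(α * n * h)) * partSum ν n (q - h) +
        (2 : ℝ) ^ (γ * n * h) * partSum ν n (q + h) +
        ∑ k ∈ charged ν n, (if (2 : ℝ) ^ (-α * n) ≤ ν.real (dyadic n k)
          then (2 : ℝ) ^ (n * (-γ * q)) else 0) := by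
        rw [Finset.sum_add_distrib, Finset.sum_add_distrib, ← Finset.mul_sum, ← Finset.mul_sum,
          partSum, partSum]
    _ ≤ _ := by
        rw [partSum_eq_rpow hν hsupp hn, partSum_eq_rpow hν hsupp hn, ← Real.rpow_add two_pos,
          ← Real.rpow_add two_pos]
        refine add_le_add (add_le_add (le_of_eq ?_) (le_of_eq ?_)) ?_
        · congr 1
          ring
        · congr 1
          ring
        · rw [← Finset.sum_filter, Finset.sum_const, nsmul_eq_mul]
          refine mul_le_mul_of_nonneg_right ?_ (by positivity)
          rw [coarseCount]
          refine Nat.cast_le.2 (Finset.card_le_card ?_)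
          intro k hk
          obtain ⟨h1, h2⟩ := Finset.mem_filter.1 hk
          exact Finset.mem_filter.2 ⟨(Finset.mem_filter.1 h1).1, h2⟩

theorem eventually_betaN_lt {ν : Measure ℝ} {q c : ℝ} (h : beta ν q < c) :
    ∀ᶠ n in atTop, betaN ν n q < c := by
  filter_upwards [eventually_lt_of_limsup_lt h] with n hn
  exact EReal.coe_lt_coe_iff.1 hn

theorem eventually_lt_betaN {ν : Measure ℝ} {q c : ℝ} (h : (c : EReal) < lowerBeta ν q) :
    ∀ᶠ n in atTop, c < betaN ν n q := by
  filter_upwards [eventually_lt_of_lt_liminf h] with n hn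
  exact EReal.coe_lt_coe_iff.1 hn

/-- Lower bound of the coarse counts at a point where `β_n` converges, in terms of upper bounds of
`β` on both sides. -/
theorem le_liminf_coarseRatio (hν : ν ≠ 0) (hsupp : ν (Ioo 0 1)ᶜ = 0) {q b h α γ η : ℝ}
    (hq : 0 ≤ q) (hh : 0 < h) (hη : 0 < η) (hb : (b : EReal) ≤ lowerBeta ν q)
    (hl : beta ν (q - h) ≤ ((b + α * h - 4 * η : ℝ) : EReal))
    (hr : beta ν (q + h) ≤ ((b - γ * h - 4 * η : ℝ) : EReal)) :
    b - 2 * η + γ * q ≤ liminf (coarseRatio ν α) atTop := by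
  refine le_liminf_of_le (isBoundedUnder_le_coarseRatio α).isCoboundedUnder_ge ?_
  have e1 := eventually_betaN_lt (ν := ν) (q := q - h) (c := b + α * h - 3 * η)
    (hl.trans_lt (EReal.coe_lt_coe_iff.2 (by linarith)))
  have e2 := eventually_betaN_lt (ν := ν) (q := q + h) (c := b - γ * h - 3 * η)
    (hr.trans_lt (EReal.coe_lt_coe_iff.2 (by linarith)))
  have e3 := eventually_lt_betaN (ν := ν) (q := q) (c := b - η)
    ((EReal.coe_lt_coe_iff.2 (by linarith)).trans_le hb)
  have e4 : ∀ᶠ n : ℕ in atTop, (3 : ℝ) ≤ (2 : ℝ) ^ (n * η) := by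
    have : Tendsto (fun n : ℕ => (2 : ℝ) ^ ((n : ℝ) * η)) atTop atTop :=
      (tendsto_rpow_atTop_of_base_gt_one 2 one_lt_two).comp
        (tendsto_natCast_atTop_atTop.atTop_mul_const hη)
    exact this.eventually_ge_atTop 3
  filter_upwards [e1, e2, e3, e4, eventually_gt_atTop 0] with n h1 h2 h3 h4 hn
  refine le_coarseRatio_of_le hn ?_
  have hn' : (0 : ℝ) ≤ n := by positivity
  have hp := partSum_le_of_exponents hn hν hsupp (q := q) (h := h) (α := α) (γ := γ) hq hh
  rw [partSum_eq_rpow hν hsupp hn] at hp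
  have i1 : (2 : ℝ) ^ (n * (betaN ν n (q - h) - α * h)) ≤ (2 : ℝ) ^ (n * (b - 3 * η)) :=
    Real.rpow_le_rpow_of_exponent_le one_le_two
      (mul_le_mul_of_nonneg_left (by linarith) hn')
  have i2 : (2 : ℝ) ^ (n * (betaN ν n (q + h) + γ * h)) ≤ (2 : ℝ) ^ (n * (b - 3 * η)) :=
    Real.rpow_le_rpow_of_exponent_le one_le_two
      (mul_le_mul_of_nonneg_left (by linarith) hn')
  have i3 : (2 : ℝ) ^ (n * (b - η)) ≤ (2 : ℝ) ^ (n * betaN ν n q) :=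
    Real.rpow_le_rpow_of_exponent_le one_le_two (mul_le_mul_of_nonneg_left h3.le hn')
  have j1 : (2 : ℝ) ^ (n * (b - η)) = (2 : ℝ) ^ (n * (b - 3 * η)) *
      ((2 : ℝ) ^ (n * η) * (2 : ℝ) ^ (n * η)) := by
    rw [← Real.rpow_add two_pos, ← Real.rpow_add two_pos]
    congr 1
    ring
  have j2 : (2 : ℝ) ^ (n * (b - 2 * η)) = (2 : ℝ) ^ (n * (b - 3 * η)) * (2 : ℝ) ^ (n * η) := by
    rw [← Real.rpow_add two_pos]
    congr 1
    ring
  have hu : 0 < (2 : ℝ) ^ (n * (b - 3 * η)) := by positivity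
  -- With `v = 2^{nη} ≥ 3` and `u = 2^{n(b-3η)}`, the partition sum is at least `u v²` and the two
  -- outer terms are at most `u` each; since `v² ≥ v + 2`, the middle term keeps at least `u v`.
  have hmid : (2 : ℝ) ^ (n * (b - 2 * η)) ≤ coarseCount ν α n * (2 : ℝ) ^ (n * (-γ * q)) := by
    have h5 : (2 : ℝ) ^ (n * η) + 2 ≤ (2 : ℝ) ^ (n * η) * (2 : ℝ) ^ (n * η) := by nlinarith
    have h6 := mul_le_mul_of_nonneg_left h5 hu.le
    rw [j1] at i3
    rw [j2]
    linarith
  have e : (2 : ℝ) ^ (n * (-γ * q)) * (2 : ℝ) ^ (n * (γ * q)) = 1 := by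
    rw [← Real.rpow_add two_pos]
    have : (n : ℝ) * (-γ * q) + n * (γ * q) = 0 := by ring
    rw [this, Real.rpow_zero]
  rw [mul_add, Real.rpow_add two_pos]
  refine (mul_le_mul_of_nonneg_right hmid (by positivity)).trans (le_of_eq ?_)
  rw [mul_assoc, e, mul_one]

end Coarse

/-! ### Regularity forces `qBar ≤ lowerF` -/

section Regular

variable {ν : Measure ℝ} [IsFiniteMeasure ν]

/-- With `α₀ = -β'(q)`, the tangent line at `q` supplies the two-sided bounds of
`le_liminf_coarseRatio` for `α = α₀ + δ` and `γ = α₀ - δ`. Letting `δ` tend to zero gives `q(1 + α₀)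
≤ lowerF (1 + α₀)`. -/
theorem le_lowerF_of_differentiableAt (hν : ν ≠ 0) (hsupp : ν (Ioo 0 1)ᶜ = 0) {q : ℝ}
    (hq : 0 ≤ q) (heq : beta ν q = lowerBeta ν q) (hle : (q : EReal) ≤ beta ν q)
    (hfin : ∀ᶠ y in 𝓝 q, beta ν y ≠ ⊤ ∧ beta ν y ≠ ⊥)
    (hd : DifferentiableAt ℝ (fun y => (beta ν y).toReal) q) : q ≤ lowerF ν := by
  set f : ℝ → ℝ := fun y => (beta ν y).toReal with hf
  set α₀ : ℝ := -deriv f q with hα₀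
  have hcoe : ∀ {y}, beta ν y ≠ ⊤ ∧ beta ν y ≠ ⊥ → ((f y : ℝ) : EReal) = beta ν y :=
    fun h => EReal.coe_toReal h.1 h.2
  have hbq := hcoe hfin.self_of_nhds
  have hqb : q ≤ f q := by
    rw [← hbq] at hle
    exact EReal.coe_le_coe_iff.1 hle
  have main : ∀ δ > 0, -(δ / 2) ≤ α₀ ∧
      q - δ + (α₀ - δ) * q ≤ lowerF ν * (1 + α₀ + δ) := by
    intro δ hδ
    have h1 : ∀ᶠ y in 𝓝 q, ‖f y - f q - (y - q) • deriv f q‖ ≤ δ / 2 * ‖y - q‖ :=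
      (hasDerivAt_iff_isLittleO.1 hd.hasDerivAt).def (half_pos hδ)
    obtain ⟨ρ, hρ, hball⟩ := Metric.eventually_nhds_iff.1 (h1.and hfin)
    set h : ℝ := min (ρ / 2) 1 with hh
    have hh0 : 0 < h := lt_min (half_pos hρ) one_pos
    have hh1 : h ≤ 1 := min_le_right _ _
    have hhρ : h < ρ := (min_le_left _ _).trans_lt (half_lt_self hρ)
    obtain ⟨hl, hlf⟩ := hball (y := q - h) (by rw [Real.dist_eq]; simp [abs_of_pos hh0, hhρ])
    obtain ⟨hr, hrf⟩ := hball (y := q + h) (by rw [Real.dist_eq]; simp [abs_of_pos hh0, hhρ])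
    rw [sub_sub_cancel_left, norm_neg, Real.norm_of_nonneg hh0.le, Real.norm_eq_abs, abs_le,
      smul_eq_mul] at hl
    rw [add_sub_cancel_left, Real.norm_of_nonneg hh0.le, Real.norm_eq_abs, abs_le,
      smul_eq_mul] at hr
    have hanti : f (q + h) ≤ f q := by
      have := beta_anti hν hsupp (by linarith : q ≤ q + h)
      rw [← hcoe hrf, ← hbq] at this
      exact EReal.coe_le_coe_iff.1 this
    -- `lowerF` only admits positive `α`. Monotonicity of `β` gives `α₀ + δ > 0`, which also covers
    -- a vanishing derivative.
    have hα0 : -(δ / 2) ≤ α₀ := by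
      have : -(δ / 2) * h ≤ α₀ * h := by
        rw [hα₀]
        linarith [hr.1]
      exact le_of_mul_le_mul_right this hh0
    refine ⟨hα0, ?_⟩
    -- The slopes are shifted by `δ` and the linearisation error is at most `δh/2`; the remaining
    -- slack `δh/2` is exactly `4η`.
    have hη : 0 < δ * h / 8 := by positivity
    have hlim := le_liminf_coarseRatio hν hsupp (q := q) (b := f q) (h := h) (α := α₀ + δ)
      (γ := α₀ - δ) hq hh0 hη (by rw [hbq, heq])
      (by
        rw [← hcoe hlf]
        refine EReal.coe_le_coe_iff.2 ?_
        rw [hα₀]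
        linarith [hl.2])
      (by
        rw [← hcoe hrf]
        refine EReal.coe_le_coe_iff.2 ?_
        rw [hα₀]
        linarith [hr.2])
    have hα : 0 < α₀ + δ := by linarith
    have hF := le_lowerF (ν := ν) hα
    rw [div_le_iff₀ (by linarith)] at hF
    have : δ * h ≤ δ := mul_le_of_le_one_right hδ.le hh1
    linarith
  have hα0 : 0 ≤ α₀ := by
    by_contra! h
    have := (main (-α₀) (by linarith)).1
    linarith
  by_contra! hlt
  have hF := lowerF_nonneg (ν := ν)
  have hden : 0 < 1 + q + lowerF ν := by linarith
  have hnum : 0 < (q - lowerF ν) * (1 + α₀) := mul_pos (by linarith) (by linarith)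
  -- `main` rearranges to `(q - lowerF ν)(1 + α₀) ≤ δ(1 + q + lowerF ν)`; this `δ` makes the right
  -- side half of the positive left side.
  have := (main ((q - lowerF ν) * (1 + α₀) / (2 * (1 + q + lowerF ν))) (by positivity)).2
  set δ := (q - lowerF ν) * (1 + α₀) / (2 * (1 + q + lowerF ν)) with hδ
  have e : δ * (2 * (1 + q + lowerF ν)) = (q - lowerF ν) * (1 + α₀) :=
    div_mul_cancel₀ _ (by positivity)
  nlinarith

/-- In the first case `β` is monotone, hence differentiable almost everywhere, so suitable `q` exist
arbitrarily close below `qBar ν`. In the second case `qBar ν` itself serves: `q ≤ β(q)` passes to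
the limit from the left by continuity. -/
theorem qBar_le_lowerF (hν : ν ≠ 0) (hsupp : ν (Ioo 0 1)ᶜ = 0) (hreg : LqRegular ν) :
    qBar ν ≤ lowerF ν := by
  rcases (qBar_nonneg hν hsupp).eq_or_lt with h0 | h0
  · rw [← h0]
    exact lowerF_nonneg
  rcases hreg with ⟨ε, hε, heq⟩ | ⟨heq, hfin, hd⟩
  · refine le_of_forall_lt_imp_le_of_dense fun c hc => ?_
    -- Above `a` the regularity hypothesis applies, any point exceeds `c`, and nonnegativity keeps
    -- `β` at most one, hence finite.
    set a := max c (max 0 (qBar ν - ε)) with ha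
    have haq : a < qBar ν := max_lt hc (max_lt h0 (by linarith))
    have ha0 : 0 ≤ a := (le_max_left _ _).trans (le_max_right _ _)
    have hfin : ∀ y ∈ Ioo a (qBar ν), beta ν y ≠ ⊤ ∧ beta ν y ≠ ⊥ := by
      intro y hy
      constructor
      · exact ((beta_le_one hν hsupp (ha0.trans hy.1.le)).trans_lt (EReal.coe_lt_top 1)).ne
      · exact ((EReal.bot_lt_coe y).trans_le (le_beta_of_lt_qBar hν hsupp hy.2)).ne'
    have hmono : MonotoneOn (fun y => -(beta ν y).toReal) (Ioo a (qBar ν)) := by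
      intro y hy z hz hyz
      exact neg_le_neg (EReal.toReal_le_toReal (beta_anti hν hsupp hyz) (hfin z hz).2 (hfin y hy).1)
    have hae := hmono.ae_differentiableWithinAt measurableSet_Ioo
    have : (ae (volume.restrict (Ioo a (qBar ν)))).NeBot := by
      rw [ae_neBot, Ne, Measure.restrict_eq_zero, Real.volume_Ioo]
      simpa using haq
    obtain ⟨q, hqd, hq⟩ := (hae.and (ae_restrict_mem measurableSet_Ioo)).exists
    have hnhds : Ioo a (qBar ν) ∈ 𝓝 q := isOpen_Ioo.mem_nhds hq
    have hqd' : DifferentiableAt ℝ (fun y => (beta ν y).toReal) q := by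
      simpa using (hqd.differentiableAt hnhds).neg
    have hqε : q ∈ Ioo (qBar ν - ε) (qBar ν) :=
      ⟨lt_of_le_of_lt ((le_max_right _ _).trans (le_max_right _ _)) hq.1, hq.2⟩
    refine le_trans ((le_max_left c _).trans hq.1.le)
      (le_lowerF_of_differentiableAt hν hsupp (ha0.trans hq.1.le) (heq q hqε)
        (le_beta_of_lt_qBar hν hsupp hq.2) ?_ hqd')
    filter_upwards [hnhds] with y hy using hfin y hy
  · refine le_lowerF_of_differentiableAt hν hsupp h0.le heq ?_ hfin hd
    rw [← EReal.coe_toReal hfin.self_of_nhds.1 hfin.self_of_nhds.2]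
    refine EReal.coe_le_coe_iff.2 ?_
    refine le_of_tendsto_of_tendsto (b := 𝓝[<] (qBar ν)) (f := fun y => y)
      (tendsto_id.mono_left nhdsWithin_le_nhds)
      (hd.continuousAt.tendsto.mono_left nhdsWithin_le_nhds) ?_
    filter_upwards [self_mem_nhdsWithin, nhdsWithin_le_nhds hfin] with y hy hyf
    have := le_beta_of_lt_qBar hν hsupp hy
    rw [← EReal.coe_toReal hyf.1 hyf.2] at this
    exact EReal.coe_le_coe_iff.1 this

end Regular

/-! ### Asymptotics of the counting function -/

section Asymptotics

theorem spectralRatio_le_of_le {ν : Measure ℝ} {x s : ℝ} {m : ℕ} (hx : 1 < x)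
    (hm : eigenCount ν x = m) (h : (m : ℝ) ≤ x ^ s) : spectralRatio ν x ≤ s := by
  have hlog : (0 : EReal) < (Real.log x : ℝ) := by exact_mod_cast Real.log_pos hx
  have hpos : 0 < x ^ s := Real.rpow_pos_of_pos (by linarith) s
  rw [spectralRatio, EReal.div_le_iff_le_mul hlog (EReal.coe_ne_top _), hm, ENat.toENNReal_coe]
  calc ENNReal.log (m : ℝ≥0∞) ≤ ENNReal.log (ENNReal.ofReal (x ^ s)) := by
        refine ENNReal.log_le_log ?_
        rw [← ENNReal.ofReal_natCast]
        exact ENNReal.ofReal_le_ofReal h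
    _ = _ := by
        rw [ENNReal.log_ofReal_of_pos hpos, Real.log_rpow (by linarith), ← EReal.coe_mul, mul_comm]

theorem le_spectralRatio_of_le {ν : Measure ℝ} {x s : ℝ} {m : ℕ} (hx : 1 < x)
    (hm : eigenCount ν x = m) (h : x ^ s ≤ (m : ℝ)) : (s : EReal) ≤ spectralRatio ν x := by
  have hlog : (0 : EReal) < (Real.log x : ℝ) := by exact_mod_cast Real.log_pos hx
  have hpos : 0 < x ^ s := Real.rpow_pos_of_pos (by linarith) s
  rw [spectralRatio, EReal.le_div_iff_mul_le hlog (EReal.coe_ne_top _), hm, ENat.toENNReal_coe]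
  calc (s : EReal) * (Real.log x : ℝ) = ENNReal.log (ENNReal.ofReal (x ^ s)) := by
        rw [ENNReal.log_ofReal_of_pos hpos, Real.log_rpow (by linarith), ← EReal.coe_mul]
    _ ≤ _ := by
        refine ENNReal.log_le_log ?_
        rw [← ENNReal.ofReal_natCast]
        exact ENNReal.ofReal_le_ofReal h

variable {ν : Measure ℝ} [IsFiniteMeasure ν]

theorem exists_eigenCount_eq_natCast {x : ℝ} (hx : 0 < x) : ∃ m : ℕ, eigenCount ν x = m := by
  obtain ⟨N, hN⟩ := exists_nat_measure_div_lt (ν := ν) (t := 1 / (2 * x)) (by positivity)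
  have h := (eigenCount_le hx hN).trans_lt (ENat.natCast_lt_top _)
  exact ⟨_, (ENat.natCast_toNat h.ne).symm⟩

/-- The number of heavy intervals of a level at which `β_n(q) ≤ q`. -/
theorem card_filter_le_rpow (hν : ν ≠ 0) (hsupp : ν (Ioo 0 1)ᶜ = 0) {q t : ℝ} (hq : 0 ≤ q)
    (ht : 0 < t) {n : ℕ} (hn : 0 < n) (hβ : betaN ν n q ≤ q)
    (s : Finset ℕ) (hs : ∀ k ∈ s, k < 2 ^ n ∧ t ≤ ν.real (dyadic n k) / 2 ^ n) :
    (s.card : ℝ) ≤ t ^ (-q) := by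
  have hsub : s ⊆ charged ν n := fun k hk => by
    have h1 := ht.trans_le (hs k hk).2
    exact mem_charged_of_pos (hs k hk).1 ((div_pos_iff_of_pos_right (by positivity)).1 h1)
  have h1 : (s.card : ℝ) * (t * 2 ^ n) ^ q ≤ ((2 : ℝ) ^ n) ^ q := by
    calc (s.card : ℝ) * (t * 2 ^ n) ^ q = ∑ k ∈ s, (t * 2 ^ n) ^ q := by
          rw [Finset.sum_const, nsmul_eq_mul]
      _ ≤ ∑ k ∈ s, ν.real (dyadic n k) ^ q := Finset.sum_le_sum fun k hk =>
          Real.rpow_le_rpow (by positivity) ((le_div_iff₀ (by positivity)).1 (hs k hk).2) hq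
      _ ≤ partSum ν n q := Finset.sum_le_sum_of_subset_of_nonneg hsub fun k _ _ =>
          Real.rpow_nonneg measureReal_nonneg q
      _ ≤ ((2 : ℝ) ^ n) ^ q := by
          rw [partSum_eq_rpow hν hsupp hn, ← Real.rpow_natCast, ← Real.rpow_mul zero_le_two]
          exact Real.rpow_le_rpow_of_exponent_le one_le_two
            (mul_le_mul_of_nonneg_left hβ (by positivity))
  rw [Real.mul_rpow ht.le (by positivity), ← mul_assoc] at h1
  have h2 : (s.card : ℝ) * t ^ q ≤ 1 := by
    have hp : 0 < ((2 : ℝ) ^ n) ^ q := by positivity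
    by_contra! h
    nlinarith
  rw [Real.rpow_neg ht.le, ← one_div, le_div_iff₀ (by positivity)]
  exact h2

/-- The finitely many levels below `n₀` are counted crudely; every later level contributes at most
`t^(-q)`. -/
theorem card_heavy_le (hν : ν ≠ 0) (hsupp : ν (Ioo 0 1)ᶜ = 0) {q : ℝ} (hq : 0 ≤ q) {n₀ : ℕ}
    (hn₀ : 0 < n₀) (hβ : ∀ n ≥ n₀, betaN ν n q ≤ q) {t : ℝ} (ht : 0 < t) (N : ℕ) :
    ((heavy ν t N).card : ℝ) ≤ n₀ * 2 ^ n₀ + N * t ^ (-q) := by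
  classical
  have htq : 0 ≤ t ^ (-q) := by positivity
  let c : ℕ → ℕ := fun n =>
    ((Finset.range (2 ^ n)).filter fun k => t ≤ ν.real (dyadic n k) / 2 ^ n).card
  have hcard : (heavy ν t N).card = ∑ n ∈ Finset.range N, c n := by
    rw [heavy, Finset.card_sigma]
  have hc : ∀ n, (c n : ℝ) ≤ (if n < n₀ then (2 : ℝ) ^ n₀ else 0) + t ^ (-q) := by
    intro n
    split_ifs with h
    · have h1 : c n ≤ 2 ^ n := by
        refine (Finset.card_filter_le _ _).trans ?_
        rw [Finset.card_range]
      have h2 : (c n : ℝ) ≤ 2 ^ n := by exact_mod_cast h1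
      have h3 : (2 : ℝ) ^ n ≤ 2 ^ n₀ := pow_le_pow_right₀ one_le_two h.le
      linarith
    · rw [zero_add]
      refine card_filter_le_rpow hν hsupp hq ht (by omega) (hβ n (by omega)) _ fun k hk => ?_
      obtain ⟨h1, h2⟩ := Finset.mem_filter.1 hk
      exact ⟨Finset.mem_range.1 h1, h2⟩
  rw [hcard, Nat.cast_sum]
  refine (Finset.sum_le_sum fun n _ => hc n).trans ?_
  rw [Finset.sum_add_distrib, Finset.sum_const, Finset.card_range, nsmul_eq_mul]
  refine add_le_add ?_ le_rfl
  rw [← Finset.sum_filter, Finset.sum_const, nsmul_eq_mul]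
  refine mul_le_mul_of_nonneg_right ?_ (by positivity)
  have : ((Finset.range N).filter fun n => n < n₀) ⊆ Finset.range n₀ := fun n hn =>
    Finset.mem_range.2 (Finset.mem_filter.1 hn).2
  have := Finset.card_le_card this
  rw [Finset.card_range] at this
  exact_mod_cast this

/-- Heavy intervals only need counting up to a level of order `log x`, so the number of levels costs
an arbitrarily small power of `x`. -/
theorem upperSpectralDim_le (hν : ν ≠ 0) (hsupp : ν (Ioo 0 1)ᶜ = 0) {s : ℝ} (hs : qBar ν < s) :
    upperSpectralDim ν ≤ s := by
  obtain ⟨q, hq, hqs⟩ := exists_between hs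
  have hq0 : 0 ≤ q := (qBar_nonneg hν hsupp).trans hq.le
  obtain ⟨n₁, hn₁⟩ := eventually_atTop.1 (eventually_betaN_le hν hsupp hq)
  set n₀ := n₁ + 1 with hn₀
  have hβ : ∀ n ≥ n₀, betaN ν n q ≤ q := fun n hn => hn₁ n (by omega)
  -- One `ε` absorbs the number of levels, the other the constant `C`.
  set ε := (s - q) / 2 with hε
  have hε0 : 0 < ε := half_pos (by linarith)
  set M := max 1 (ν.real univ) with hM
  have hM1 : 1 ≤ M := le_max_left _ _
  set C : ℝ := n₀ * 2 ^ n₀ + ((2 * M) ^ ε / ε / Real.log 2 + 1) * 2 ^ q with hC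
  have hl2 : 0 < Real.log 2 := Real.log_pos one_lt_two
  have key : ∀ x : ℝ, 1 < x → ∃ m : ℕ, eigenCount ν x = m ∧ (m : ℝ) ≤ C * x ^ (q + ε) := by
    intro x hx
    have hx0 : 0 < x := by linarith
    obtain ⟨m, hm⟩ := exists_eigenCount_eq_natCast (ν := ν) hx0
    refine ⟨m, hm, ?_⟩
    have h2Mx : 1 ≤ 2 * M * x := by nlinarith
    -- Level `n + 1` is fine enough for every interval to be light, while `2^n ≤ 2Mx` keeps `n`
    -- logarithmic in `x`.
    obtain ⟨n, hn1, hn2⟩ := exists_nat_pow_near h2Mx one_lt_two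
    have hN : ν.real univ / 2 ^ (n + 1) < 1 / (2 * x) := by
      rw [div_lt_div_iff₀ (by positivity) (by positivity), one_mul]
      refine lt_of_le_of_lt ?_ hn2
      have : ν.real univ ≤ M := le_max_right _ _
      nlinarith
    have h1 := eigenCount_le hx0 hN
    rw [hm, Nat.cast_le] at h1
    have h2 := card_heavy_le hν hsupp hq0 (by omega) hβ (t := 1 / (2 * x)) (by positivity) (n + 1)
    have h3 : (1 / (2 * x)) ^ (-q) = 2 ^ q * x ^ q := by
      rw [one_div, Real.inv_rpow (by positivity), Real.rpow_neg (by positivity), inv_inv,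
        Real.mul_rpow zero_le_two hx0.le]
    have h4 : (n : ℝ) ≤ (2 * M) ^ ε / ε / Real.log 2 * x ^ ε := by
      have h5 : (n : ℝ) * Real.log 2 ≤ Real.log (2 * M * x) := by
        rw [← Real.log_pow]
        exact Real.log_le_log (by positivity) hn1
      have h6 := h5.trans (Real.log_le_rpow_div (by positivity) hε0)
      rw [Real.mul_rpow (by positivity) hx0.le] at h6
      rw [div_mul_eq_mul_div, le_div_iff₀ hl2, div_mul_eq_mul_div]
      exact h6
    have hxq : 1 ≤ x ^ q := Real.one_le_rpow hx.le hq0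
    have hxε : 1 ≤ x ^ ε := Real.one_le_rpow hx.le hε0.le
    have hK : 0 ≤ (2 * M) ^ ε / ε / Real.log 2 := by positivity
    rw [h3] at h2
    push_cast at h2
    rw [Real.rpow_add hx0]
    have hA : (0 : ℝ) ≤ n₀ * 2 ^ n₀ := by positivity
    have b1 : (n₀ : ℝ) * 2 ^ n₀ ≤ n₀ * 2 ^ n₀ * (x ^ q * x ^ ε) :=
      le_mul_of_one_le_right hA (one_le_mul_of_one_le_of_one_le hxq hxε)
    have b2 : ((n : ℝ) + 1) * (2 ^ q * x ^ q) ≤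
        ((2 * M) ^ ε / ε / Real.log 2 + 1) * x ^ ε * (2 ^ q * x ^ q) := by
      refine mul_le_mul_of_nonneg_right ?_ (by positivity)
      linarith
    calc (m : ℝ) ≤ _ := by exact_mod_cast h1
      _ ≤ _ := h2
      _ ≤ n₀ * 2 ^ n₀ * (x ^ q * x ^ ε) +
          ((2 * M) ^ ε / ε / Real.log 2 + 1) * x ^ ε * (2 ^ q * x ^ q) := by
        rw [hn₀] at b1 ⊢
        push_cast at b1 ⊢
        exact add_le_add b1 b2
      _ = _ := by rw [hC]; ring
  refine limsup_le_of_le (by isBoundedDefault) ?_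
  filter_upwards [eventually_gt_atTop (1 : ℝ), (tendsto_rpow_atTop hε0).eventually_ge_atTop C]
    with x hx hxC
  obtain ⟨m, hm, hmC⟩ := key x hx
  have hx0 : 0 < x := by linarith
  refine spectralRatio_le_of_le hx hm (hmC.trans ?_)
  have e : x ^ s = x ^ ε * x ^ (q + ε) := by
    rw [← Real.rpow_add hx0]
    congr 1
    rw [hε]
    ring
  rw [e]
  exact mul_le_mul_of_nonneg_right hxC (by positivity)

theorem lowerSpectralDim_nonneg (hν : ν ≠ 0) (hsupp : ν (Ioo 0 1)ᶜ = 0) :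
    0 ≤ lowerSpectralDim ν := by
  obtain ⟨x₀, hx₀⟩ := exists_one_le_eigenCount hν hsupp
  refine le_liminf_of_le (by isBoundedDefault) ?_
  filter_upwards [eventually_ge_atTop x₀, eventually_gt_atTop (1 : ℝ)] with x h1 h2
  obtain ⟨m, hm⟩ := exists_eigenCount_eq_natCast (ν := ν) (by linarith : 0 < x)
  rw [← EReal.coe_zero]
  refine le_spectralRatio_of_le h2 hm ?_
  have h3 := hx₀.trans (eigenCount_mono h1)
  rw [hm] at h3
  rw [Real.rpow_zero]
  exact_mod_cast h3

/-- The bound of `coarseCount_le` lives on the sequence `2yⁿ` with `y = 2^(1+α)`; monotonicity of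
the counting function transfers it to all `x` at the cost of a factor `y^c`. -/
theorem le_lowerSpectralDim {α c : ℝ} (hα : 0 < α) (hc : 0 ≤ c)
    (h : c < liminf (coarseRatio ν α) atTop / (1 + α)) : (c : EReal) ≤ lowerSpectralDim ν := by
  rw [lt_div_iff₀ (by linarith)] at h
  obtain ⟨a, hca, ha⟩ := exists_between h
  have ha0 : 0 < a := lt_of_le_of_lt (by positivity) hca
  have hev := eventually_lt_of_lt_liminf ha (isBoundedUnder_ge_coarseRatio α)
  set y : ℝ := (2 : ℝ) ^ (1 + α) with hy
  have hy1 : 1 < y := Real.one_lt_rpow one_lt_two (by linarith)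
  -- `K` collects the interpolation factor and the constants `3` and `2` of `coarseCount_le`; the
  -- strict gap between `a` and `c(1 + α)` eventually dominates it.
  set K : ℝ := 3 * (2 * y) ^ c + 2 with hK
  have hpow : ∀ᶠ n : ℕ in atTop, K ≤ (2 : ℝ) ^ (n * (a - c * (1 + α))) := by
    have : Tendsto (fun n : ℕ => (2 : ℝ) ^ ((n : ℝ) * (a - c * (1 + α)))) atTop atTop :=
      (tendsto_rpow_atTop_of_base_gt_one 2 one_lt_two).comp
        (tendsto_natCast_atTop_atTop.atTop_mul_const (by linarith))
    exact this.eventually_ge_atTop K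
  obtain ⟨n₁, hn₁⟩ := eventually_atTop.1 (hev.and (hpow.and (eventually_gt_atTop 0)))
  refine le_liminf_of_le (by isBoundedDefault) ?_
  filter_upwards [eventually_ge_atTop (2 * y ^ (n₁ + 1)), eventually_ge_atTop (2 : ℝ)] with x hx hx2
  have hx0 : 0 < x := by linarith
  obtain ⟨n, hn1, hn2⟩ := exists_nat_pow_near (by linarith : 1 ≤ x / 2) hy1
  have hnn : n₁ ≤ n := by
    by_contra! hlt
    have : y ^ (n + 1) ≤ y ^ (n₁ + 1) := pow_le_pow_right₀ hy1.le (by omega)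
    linarith
  obtain ⟨h1, h2, hn0⟩ := hn₁ n hnn
  obtain ⟨m, hm⟩ := exists_eigenCount_eq_natCast (ν := ν) hx0
  refine le_spectralRatio_of_le (by linarith) hm ?_
  have hyn : y ^ n = (2 : ℝ) ^ ((1 + α) * n) := by
    rw [hy, Real.rpow_mul zero_le_two, Real.rpow_natCast]
  have hcount : (coarseCount ν α n : ℝ) ≤ 3 * m + 2 := by
    have h3 := coarseCount_le (ν := ν) α n
    have h4 : eigenCount ν (2 * (2 : ℝ) ^ ((1 + α) * n)) ≤ m := by
      rw [← hm]
      refine eigenCount_mono ?_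
      rw [← hyn]
      linarith
    have h5 : (coarseCount ν α n : ℕ∞) ≤ 3 * (m : ℕ∞) + 2 := h3.trans (by gcongr)
    exact_mod_cast h5
  have hlow : (2 : ℝ) ^ (n * a) ≤ coarseCount ν α n := by
    rw [coarseRatio, lt_div_iff₀ (log_two_pow_pos hn0), Real.posLog, lt_max_iff] at h1
    have hp : 0 < a * Real.log ((2 : ℝ) ^ n) := mul_pos ha0 (log_two_pow_pos hn0)
    have h6 := h1.resolve_left (not_lt.2 hp.le)
    have hcpos : (0 : ℝ) < coarseCount ν α n := by
      rcases (coarseCount ν α n).eq_zero_or_pos with h0 | h0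
      · rw [h0, Nat.cast_zero, Real.log_zero] at h6
        linarith
      · exact_mod_cast h0
    refine ((Real.lt_log_iff_exp_lt hcpos).1 h6).le.trans' (le_of_eq ?_)
    rw [Real.rpow_def_of_pos two_pos, Real.log_pow]
    congr 1
    ring
  have hxc : x ^ c ≤ (2 * y) ^ c * (2 : ℝ) ^ (n * (c * (1 + α))) := by
    have h7 : x ≤ 2 * y * y ^ n := by
      rw [pow_succ] at hn2
      linarith
    refine (Real.rpow_le_rpow hx0.le h7 hc).trans (le_of_eq ?_)
    rw [Real.mul_rpow (by positivity) (by positivity), hyn, ← Real.rpow_mul zero_le_two]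
    congr 2
    ring
  set u : ℝ := (2 : ℝ) ^ (n * (c * (1 + α))) with hu
  have hu1 : 1 ≤ u := Real.one_le_rpow one_le_two (by positivity)
  have hsplit : (2 : ℝ) ^ (n * a) = (2 : ℝ) ^ (n * (a - c * (1 + α))) * u := by
    rw [hu, ← Real.rpow_add two_pos]
    congr 1
    ring
  have h8 : K * u ≤ (2 : ℝ) ^ (n * a) := by
    rw [hsplit]
    exact mul_le_mul_of_nonneg_right h2 (by linarith)
  rw [hK, add_mul] at h8
  linarith

/-- A nearly optimal `α` in the supremum defining `lowerF` suffices. The case `qBar ν = 0` is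
separate because the positive part of `c` must lie strictly below that supremum. -/
theorem qBar_le_lowerSpectralDim (hν : ν ≠ 0) (hsupp : ν (Ioo 0 1)ᶜ = 0) (hreg : LqRegular ν) :
    (qBar ν : EReal) ≤ lowerSpectralDim ν := by
  rcases (qBar_nonneg hν hsupp).eq_or_lt with h0 | h0
  · rw [← h0, EReal.coe_zero]
    exact lowerSpectralDim_nonneg hν hsupp
  refine EReal.ge_of_forall_gt_iff_ge.1 fun c hc => ?_
  have hc' : c < qBar ν := EReal.coe_lt_coe_iff.1 hc
  have hlt : max c 0 < lowerF ν :=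
    (max_lt hc' h0).trans_le (qBar_le_lowerF hν hsupp hreg)
  obtain ⟨α, hα⟩ := exists_lt_of_lt_ciSup hlt
  refine le_trans ?_ (le_lowerSpectralDim α.2 (le_max_right c 0) hα)
  exact EReal.coe_le_coe_iff.2 (le_max_left c 0)

theorem upperSpectralDim_le_qBar (hν : ν ≠ 0) (hsupp : ν (Ioo 0 1)ᶜ = 0) :
    upperSpectralDim ν ≤ qBar ν :=
  EReal.le_of_forall_lt_iff_le.1 fun _ hs =>
    upperSpectralDim_le hν hsupp (EReal.coe_lt_coe_iff.1 hs)

end Asymptotics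

end KreinFeller

end

theorem theorem1p2 (ν : MeasureTheory.Measure ℝ) [MeasureTheory.IsFiniteMeasure ν]
    (hν : ν ≠ 0) (hsupp : ν (Set.Ioo 0 1)ᶜ = 0) (hreg : KreinFeller.LqRegular ν) :
    KreinFeller.MFRegular ν ∧ KreinFeller.HasSpectralDim ν (KreinFeller.qBar ν) := by
  have hF := KreinFeller.qBar_le_lowerF hν hsupp hreg
  have hU := KreinFeller.upperF_le_qBar hν hsupp
  have hlow := KreinFeller.qBar_le_lowerSpectralDim hν hsupp hreg
  have hup := KreinFeller.upperSpectralDim_le_qBar hν hsupp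
  have hle : KreinFeller.lowerSpectralDim ν ≤ KreinFeller.upperSpectralDim ν :=
    Filter.liminf_le_limsup
  exact ⟨le_antisymm KreinFeller.lowerF_le_upperF (hU.trans hF),
    le_antisymm (hle.trans hup) hlow, le_antisymm hup (hlow.trans hle)⟩
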